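/- Let $D=(G,\mathcal O,w)$ be a weighted oriented graph: $G$ is a finite simple graph, $\mathcal O$ gives each edge of $G$ one direction, and $w:V(G)\to\{1,2,\dots\}$. Let $E(D)$ be the set of oriented edges, $N_D^+(A)=\{y\mid (x,y)\in E(D)\text{ for some }x\in A\}$ for $A\subseteq V(G)$, $N_D(x)$ the set of neighbours of $x$ in $G$, and $V^+=\{x\mid w(x)>1\}$. Let $K$ be a field and let $I(D)=(xy^{w(y)}\mid (x,y)\in E(D))$ be the edge ideal of $D$ in the polynomial ring over $K$ whose variables are the vertices of $G$. An ideal is unmixed if all its associated primes have the same height. Subgraphs of $D$ carry the inherited orientation and weights. A root oriented tree (ROT) with parent $v$ is a subgraph $T$ of $D$ without cycles, with $v\in V(T)$, such that every $x\in V(T)\setminus\{v\}$ is reached from $v$ by an oriented path in $T$, and every $x\in V(T)$ with $w(x)=1$ satisfies either $\deg_T(x)=1$ and $x\ne v$, or $V(T)=\{v\}$ and $x=v$. A unicycle oriented subgraph is a subgraph $B$ of $D$ with exactly one cycle $C$, such that $C$ is an oriented cycle, every $y\in V(B)\setminus V(C)$ is reached from a vertex of $C$ by an oriented path in $B$, and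 $\deg_B(x)=1$ for every $x\in V(B)$ with $w(x)=1$. A $\star$-semi-forest of $D$ is a subgraph $H=\bigcup_{i=1}^r T_i\cup\bigcup_{j=1}^t B_j$ $(r,t\ge 0)$, where the $T_i$ are ROTs with parents $v_i$ and the $B_j$ are unicycle oriented subgraphs, such that (i) the sets $V(T_1),\dots,V(T_r),V(B_1),\dots,V(B_t)$ are pairwise disjoint; (ii) there are (not necessarily distinct) $u_1,\dots,u_r\in V(G)\setminus V(H)$ with $u_i\in N_D(v_i)$; (iii) the set $\{u_1,\dots,u_r\}$ is the disjoint union of two (possibly empty) sets $W_1,W_2$ such that $W_1$ is stable in $G$, $W_2\subseteq V^+$, $(u_i,v_i)\in E(D)$ whenever $u_i\in W_2$, and $N_D^+(W_2\cup\tilde H)\cap W_1=\emptyset$, where $\tilde H=\{x\in V(H)\mid\deg_H(x)\ge2\}\cup\{v_i\mid\deg_H(v_i)=1\}$. A generating $\star$-semi-forest of a subgraph $H'$ of $D$ is a $\star$-semi-forest $H$ of $D$ with $V(H)=V(H')$. Let $\tau(\cdot)$ denote the minimum cardinality of a vertex cover. A $\tau$-reduction of $G$ is a collection of nonempty, pairwise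 disjoint induced subgraphs $H_1,\dots,H_s$ of $G$ with $V(G)=\bigcup_i V(H_i)$ and $\tau(G)=\sum_i\tau(H_i)$. The graph $G$ is perfect if the chromatic number equals the clique number for every induced subgraph of $G$. Theorem. Suppose that $G$ is perfect. Then there is a proper colouring of the complement $\overline G$ with $s=\chi(\overline G)$ colours such that the subgraphs $H_1,\dots,H_s$ of $G$ induced by its colour classes are complete and form a $\tau$-reduction of $G$. Furthermore, for every $\tau$-reduction $H_1,\dots,H_s$ of $G$ into complete subgraphs (in particular for the one above), $I(D)$ is unmixed if and only if no $H_i$ has a generating $\star$-semi-forest. -/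

import Mathlib

/-- A weighted oriented graph on the vertex set `V`: a simple graph, a choice of exactly one
direction for each of its edges, and positive integer weights on the vertices.
`arc x y` means that `(x, y)` is an oriented edge. -/
structure WeightedOrientedGraph (V : Type*) where
  /-- the underlying simple graph -/
  G : SimpleGraph V
  /-- the oriented edges -/
  arc : V → V → Prop
  /-- the weights -/
  w : V → ℕ
  adj_iff : ∀ x y, G.Adj x y ↔ arc x y ∨ arc y x
  arc_asymm : ∀ x y, arc x y → ¬ arc y x
  one_le_w : ∀ x, 1 ≤ w x

namespace WeightedOrientedGraph

variable {V : Type*}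

/-- The set `V⁺` of vertices of weight greater than one. -/
def heavy (D : WeightedOrientedGraph V) : Set V := {x | 1 < D.w x}

/-- The edge ideal of `D` in the polynomial ring over `K` whose variables are the vertices: it is
generated by the monomials `x * y ^ w(y)` for the oriented edges `(x, y)`. -/
noncomputable def edgeIdeal (D : WeightedOrientedGraph V) (K : Type*) [Field K] :
    Ideal (MvPolynomial V K) :=
  Ideal.span {f | ∃ x y, D.arc x y ∧ f = MvPolynomial.X x * MvPolynomial.X y ^ D.w y}

/-! A weighted oriented subgraph of `D` inherits its orientation and its weights from `D`, so it is
the same thing as a subgraph of the underlying graph, `H : D.G.Subgraph`; its oriented edges are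
the pairs `(x, y)` with `H.Adj x y` and `D.arc x y`. -/

/-- The degree of `x` in the subgraph `H`. -/
noncomputable def deg (D : WeightedOrientedGraph V) (H : D.G.Subgraph) (x : V) : ℕ :=
  (H.neighborSet x).ncard

/-- A walk all of whose steps follow the orientation. -/
def IsOriented (D : WeightedOrientedGraph V) {x y : V} (p : D.G.Walk x y) : Prop :=
  ∀ d ∈ p.darts, D.arc d.fst d.snd

/-- There is an oriented path from `x` to `y` inside the subgraph `H`
(a path of length zero is allowed). -/
def HasOrientedPath (D : WeightedOrientedGraph V) (H : D.G.Subgraph) (x y : V) : Prop :=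
  ∃ p : D.G.Walk x y, p.IsPath ∧ D.IsOriented p ∧ p.toSubgraph ≤ H

/-- The set of (not necessarily oriented) cycles of `H`, each regarded as a subgraph. -/
def cycles (D : WeightedOrientedGraph V) (H : D.G.Subgraph) : Set D.G.Subgraph :=
  {C | C ≤ H ∧ ∃ (x : V) (p : D.G.Walk x x), p.IsCycle ∧ p.toSubgraph = C}

/-- `C` is an oriented cycle. -/
def IsOrientedCycle (D : WeightedOrientedGraph V) (C : D.G.Subgraph) : Prop :=
  ∃ (x : V) (p : D.G.Walk x x), p.IsCycle ∧ D.IsOriented p ∧ p.toSubgraph = C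

/-- `B` is a unicycle oriented subgraph: it has exactly one cycle `C`, this cycle is oriented,
every other vertex is reached from `C` by an oriented path in `B`, and the vertices of weight one
have degree one in `B`. -/
def IsUnicycle (D : WeightedOrientedGraph V) (B : D.G.Subgraph) : Prop :=
  ∃ C : D.G.Subgraph, D.cycles B = {C} ∧
    D.IsOrientedCycle C ∧
    (∀ y ∈ B.verts \ C.verts, ∃ c ∈ C.verts, D.HasOrientedPath B c y) ∧
    ∀ x ∈ B.verts, D.w x = 1 → D.deg B x = 1

/-- `T` is a root oriented tree with parent `v`. -/
def IsROT (D : WeightedOrientedGraph V) (T : D.G.Subgraph) (v : V) : Prop :=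
  v ∈ T.verts ∧
    D.cycles T = ∅ ∧
    (∀ x ∈ T.verts \ {v}, D.HasOrientedPath T v x) ∧
    ∀ x ∈ T.verts, D.w x = 1 → (D.deg T x = 1 ∧ x ≠ v) ∨ (T.verts = {v} ∧ x = v)

/-- For a subgraph `H` and parents `v i`, the set consisting of the vertices of degree at least two
in `H` together with the parents of degree one in `H`. -/
def inner (D : WeightedOrientedGraph V) (H : D.G.Subgraph) {r : ℕ} (v : Fin r → V) : Set V :=
  {x | x ∈ H.verts ∧ 2 ≤ D.deg H x} ∪ {x | ∃ i, x = v i ∧ D.deg H (v i) = 1}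

/-- `H` is a ⋆-semi-forest of `D`: the union of root oriented trees `T i` with parents `v i` and of
unicycle oriented subgraphs `B j`, whose vertex sets partition that of `H`, together with vertices
`u i` outside `H` adjacent to the parents and a partition `W₁`, `W₂` (parts may be empty) of the set
of all `u i` with the required properties. -/
def IsStarSemiForest (D : WeightedOrientedGraph V) (H : D.G.Subgraph) : Prop :=
  ∃ (r t : ℕ) (T : Fin r → D.G.Subgraph) (v : Fin r → V) (B : Fin t → D.G.Subgraph),
    (∀ i, D.IsROT (T i) (v i)) ∧
    (∀ j, D.IsUnicycle (B j)) ∧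
    H = (⨆ i, T i) ⊔ (⨆ j, B j) ∧
    (∀ i i', i ≠ i' → Disjoint (T i).verts (T i').verts) ∧
    (∀ j j', j ≠ j' → Disjoint (B j).verts (B j').verts) ∧
    (∀ i j, Disjoint (T i).verts (B j).verts) ∧
    ∃ u : Fin r → V,
      (∀ i, u i ∉ H.verts ∧ D.G.Adj (v i) (u i)) ∧
      ∃ W₁ W₂ : Set V,
        W₁ ∪ W₂ = Set.range u ∧ Disjoint W₁ W₂ ∧
        D.G.IsIndepSet W₁ ∧
        W₂ ⊆ D.heavy ∧
        (∀ i, u i ∈ W₂ → D.arc (u i) (v i)) ∧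
        ∀ x ∈ W₂ ∪ D.inner H v, ∀ y ∈ W₁, ¬ D.arc x y

/-- The subgraph `K` has a generating ⋆-semi-forest. -/
def HasGeneratingStarSemiForest (D : WeightedOrientedGraph V) (K : D.G.Subgraph) : Prop :=
  ∃ H : D.G.Subgraph, D.IsStarSemiForest H ∧ K.verts = H.verts

end WeightedOrientedGraph

/-- An ideal is unmixed if all its associated primes have the same height. -/
def Ideal.IsUnmixedIdeal {R : Type*} [CommRing R] (I : Ideal R) : Prop :=
  ∀ P ∈ associatedPrimes R (R ⧸ I), ∀ Q ∈ associatedPrimes R (R ⧸ I), P.height = Q.height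

namespace SimpleGraph

variable {V : Type*}

/-- A (finite) graph is perfect if the chromatic number and the clique number agree for each of its
induced subgraphs. -/
def IsPerfectGraph (G : SimpleGraph V) : Prop :=
  ∀ A : Set V, (G.induce A).chromaticNumber = ((G.induce A).cliqueNum : ℕ∞)

/-- `H 0, …, H (s - 1)` is a τ-reduction of `G`: nonempty, pairwise disjoint induced subgraphs which
cover the vertices of `G` and whose vertex cover numbers add up to that of `G`. -/
def IsTauReduction (G : SimpleGraph V) {s : ℕ} (H : Fin s → G.Subgraph) : Prop :=
  (∀ i, (H i).verts.Nonempty) ∧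
    (∀ i, (H i).IsInduced) ∧
    (∀ i j, i ≠ j → Disjoint (H i).verts (H j).verts) ∧
    (⋃ i, (H i).verts) = Set.univ ∧
    G.vertexCoverNum = ∑ i, (H i).coe.vertexCoverNum

end SimpleGraph

/-! The associated primes of `I(D)` are exactly the ideals generated by the strong vertex covers
(`associatedPrimes_of_isStrongCover`, `exists_isStrongCover_of_mem_associatedPrimes`), and the
height of such a prime is the size of its cover. Hence `I(D)` is unmixed iff all strong covers have
the same size, which must be `τ(G)` because a minimum cover is strong.

A vertex cover `C` misses at most one vertex of a clique. For a τ-reduction into cliques this gives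
`|C| ≥ ∑ (|H_i| - 1) = τ(G)`, with equality iff `C` contains no whole `H_i`. So `I(D)` is unmixed
iff no strong cover contains some `V(H_i)`, and `hasGeneratingStarSemiForest_iff` says that a strong
cover containing a given vertex set exists exactly when there is a generating ⋆-semi-forest on that
set. From forest to cover, one takes a minimal cover avoiding `W₁` and containing the forest and all
out-neighbours of `W₂` and of `inner`. From cover to forest, each vertex chooses a parent among the
witnesses of strongness, and the components of this functional graph are the trees and unicycles.

The τ-reduction comes from the weak perfect graph theorem: the complement can be coloured with as
many colours as some stable set `S` of `G` has vertices, so each colour class is a clique containing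
exactly one vertex of `S`. The theorem is proved by Gasparyan's rank argument for Lovász's criterion
`|A| ≤ ω(A) α(A)`, which is symmetric under complementation. -/

open MvPolynomial

/-! ### Colon ideals of monomial ideals and primes generated by variables. -/

section MonomialIdeals

variable {V K : Type*} [Field K]

/-- The sum of those terms of a polynomial whose exponents satisfy a given predicate. -/
theorem MvPolynomial.exists_coeff_eq_ite (p : (V →₀ ℕ) → Prop) [DecidablePred p]
    (f : MvPolynomial V K) :
    ∃ g : MvPolynomial V K, ∀ m, coeff m g = if p m then coeff m f else 0 := by
  classical
  refine ⟨∑ m ∈ f.support with p m, monomial m (coeff m f), fun m => ?_⟩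
  simp only [coeff_sum, coeff_monomial, Finset.sum_ite_eq', Finset.mem_filter, mem_support_iff]
  by_cases h : coeff m f = 0 <;> simp [h]

/-- Let `I` be a monomial ideal, let `f ≠ 0` be such that no term of `f` lies in `I` even after
multiplication by a monomial in the variables outside `C`, and let the variables in `C` multiply
`f` into `I`. Then every polynomial multiplying `f` into `I` lies in the ideal of `C`. -/
theorem MvPolynomial.mem_span_X_of_mul_mem {I : Ideal (MvPolynomial V K)}
    {M : (V →₀ ℕ) → Prop} (hI : ∀ f, f ∈ I ↔ ∀ m ∈ f.support, M m) {C : Set V}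
    {f g : MvPolynomial V K} (hf : f ≠ 0)
    (hfM : ∀ m ∈ f.support, ∀ b : V →₀ ℕ, (∀ x ∈ C, b x = 0) → ¬ M (b + m))
    (hC : ∀ h ∈ Ideal.span (X '' C : Set (MvPolynomial V K)), h * f ∈ I) (hg : g * f ∈ I) :
    g ∈ Ideal.span (X '' C : Set (MvPolynomial V K)) := by
  classical
  -- `g₀` is the part of `g` free of the variables in `C`. Then `g₀ * f` lies in `I`, yet none of
  -- its terms can, so it vanishes.
  obtain ⟨g₀, hg₀⟩ := exists_coeff_eq_ite (fun b => ∀ x ∈ C, b x = 0) g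
  have hsub : g - g₀ ∈ Ideal.span (X '' C : Set (MvPolynomial V K)) := by
    rw [mem_ideal_span_X_image]
    intro m hm
    rw [mem_support_iff, coeff_sub, hg₀] at hm
    by_contra! hcon
    rw [if_pos hcon, sub_self] at hm
    exact hm rfl
  have hg₀f : g₀ * f ∈ I := by
    have h : g₀ * f = g * f - (g - g₀) * f := by ring
    rw [h]
    exact I.sub_mem hg (hC _ hsub)
  have hzero : g₀ * f = 0 := by
    by_contra hne
    obtain ⟨m, hm⟩ := support_nonempty.mpr hne
    have hM := (hI _).1 hg₀f m hm
    obtain ⟨b, hb, c, hc, rfl⟩ := Finset.mem_add.1 (support_mul _ _ hm)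
    rw [mem_support_iff, hg₀] at hb
    refine hfM c hc b ?_ hM
    by_contra hcon
    exact hb (if_neg hcon)
  have : g₀ = 0 := (mul_eq_zero.1 hzero).resolve_right hf
  simpa [this] using hsub

/-- The preceding lemma applies with `I` this ideal itself, once `f` is replaced by its part `f₀`
free of the variables in `C`. -/
theorem MvPolynomial.isPrime_span_X_image (C : Set V) :
    (Ideal.span (X '' C : Set (MvPolynomial V K))).IsPrime := by
  classical
  have hI (f : MvPolynomial V K) : f ∈ Ideal.span (X '' C : Set (MvPolynomial V K)) ↔
      ∀ m ∈ f.support, ∃ i ∈ C, m i ≠ 0 := mem_ideal_span_X_image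
  refine ⟨fun h => ?_, fun {g f} hgf => ?_⟩
  · have := (hI 1).1 ((Ideal.eq_top_iff_one _).1 h) 0 (by simp)
    simp at this
  · by_contra! hcon
    obtain ⟨f₀, hf₀⟩ := exists_coeff_eq_ite (fun b => ∀ x ∈ C, b x = 0) f
    have hsub : f - f₀ ∈ Ideal.span (X '' C : Set (MvPolynomial V K)) := by
      rw [hI]
      intro m hm
      rw [mem_support_iff, coeff_sub, hf₀] at hm
      by_contra! hcon
      rw [if_pos hcon, sub_self] at hm
      exact hm rfl
    refine hcon.1 (mem_span_X_of_mul_mem (f := f₀) hI ?_ ?_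
      (fun h hh => Ideal.mul_mem_right _ _ hh) ?_)
    · rintro rfl
      exact hcon.2 (by simpa using hsub)
    · intro m hm b hb hM
      obtain ⟨i, hi, hne⟩ := hM
      rw [mem_support_iff, hf₀] at hm
      have : ∀ x ∈ C, m x = 0 := by
        by_contra h
        exact hm (if_neg h)
      exact hne (by simp [hb i hi, this i hi])
    · have h : g * f₀ = g * f - g * (f - f₀) := by ring
      rw [h]
      exact Ideal.sub_mem _ hgf (Ideal.mul_mem_left _ _ hsub)

theorem MvPolynomial.X_mem_span_X_image {C : Set V} {x : V} :
    (X x : MvPolynomial V K) ∈ Ideal.span (X '' C : Set (MvPolynomial V K)) ↔ x ∈ C := by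
  classical
  rw [mem_ideal_span_X_image, support_X]
  simp [Finsupp.single_apply]

/-- The height of a prime ideal generated by variables is the number of these variables. -/
theorem MvPolynomial.height_span_X_image [Finite V] (C : Set V) :
    (Ideal.span (X '' C : Set (MvPolynomial V K))).height = C.encard := by
  have hprime := fun C : Set V => isPrime_span_X_image (K := K) C
  apply le_antisymm
  -- Krull's height theorem gives the upper bound; for the lower one, each further variable gives a
  -- strictly larger prime.
  · refine (Ideal.height_le_spanFinrank _ (hprime C).ne_top).trans ?_
    rw [← (Set.toFinite C).cast_ncard_eq, Nat.cast_le]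
    exact (Submodule.spanFinrank_span_le_ncard_of_finite (Set.toFinite _)).trans
      (Set.ncard_image_le (Set.toFinite C))
  · induction C, Set.toFinite C using Set.Finite.induction_on with
    | empty => simp
    | @insert a s ha hs ih =>
      rw [Set.encard_insert_of_notMem ha]
      have h1 := hprime s
      have h2 := hprime (insert a s)
      have hlt : Ideal.span (X '' s : Set (MvPolynomial V K)) <
          Ideal.span (X '' (insert a s) : Set (MvPolynomial V K)) := by
        refine lt_of_le_of_ne (Ideal.span_mono (Set.image_mono (Set.subset_insert a s))) ?_
        intro h
        apply ha
        rw [← X_mem_span_X_image (K := K), h, X_mem_span_X_image]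
        exact Set.mem_insert a s
      have := Ideal.height_strict_mono_of_isPrime_of_isPrime hlt
      exact (add_le_add_left ih 1).trans (Order.add_one_le_of_lt this)

theorem Ideal.mem_associatedPrimes_quotient_iff {R : Type*} [CommRing R] [IsNoetherianRing R]
    {I P : Ideal R} :
    P ∈ associatedPrimes R (R ⧸ I) ↔ P.IsPrime ∧ ∃ f, ∀ r, r ∈ P ↔ r * f ∈ I := by
  refine Iff.trans (isAssociatedPrime_iff (I := P) (M := R ⧸ I)) (and_congr_right fun _ => ?_)
  have key (f r : R) : r ∈ (⊥ : Submodule R (R ⧸ I)).colon {Ideal.Quotient.mk I f} ↔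
      r * f ∈ I := by
    rw [Submodule.mem_colon_singleton, Submodule.mem_bot, ← Ideal.Quotient.eq_zero_iff_mem]
    rfl
  constructor
  · rintro ⟨x, rfl⟩
    obtain ⟨f, rfl⟩ := Ideal.Quotient.mk_surjective x
    exact ⟨f, key f⟩
  · rintro ⟨f, hf⟩
    exact ⟨Ideal.Quotient.mk I f, Ideal.ext fun r => (hf r).trans (key f r).symm⟩

theorem MvPolynomial.exists_X_mem_of_monomial_mem {P : Ideal (MvPolynomial V K)} (hP : P.IsPrime)
    {m : V →₀ ℕ} (hm : monomial m 1 ∈ P) : ∃ x, m x ≠ 0 ∧ X x ∈ P := by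
  rw [monomial_eq, C_1, one_mul, Finsupp.prod, hP.prod_mem_iff] at hm
  obtain ⟨x, hx, hxP⟩ := hm
  exact ⟨x, Finsupp.mem_support_iff.1 hx, hP.mem_of_pow_mem _ hxP⟩

end MonomialIdeals

/-! ### Associated primes of the edge ideal and strong vertex covers. -/

namespace WeightedOrientedGraph

variable {V : Type*} (D : WeightedOrientedGraph V)

/-- A vertex cover is strong if each of its vertices without neighbours outside the cover receives
an arc from a vertex of weight greater than one in the cover, all of whose arcs end in the cover. -/
def IsStrongCover (C : Set V) : Prop :=
  D.G.IsVertexCover C ∧ ∀ x ∈ C, (∀ y, D.G.Adj x y → y ∈ C) →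
    ∃ y ∈ C, D.arc y x ∧ 1 < D.w y ∧ ∀ z, D.arc y z → z ∈ C

variable {D}

theorem arc_ne {x y : V} (h : D.arc x y) : x ≠ y := by
  rintro rfl
  exact D.arc_asymm _ _ h h

theorem adj_of_arc {x y : V} (h : D.arc x y) : D.G.Adj x y := (D.adj_iff x y).2 (Or.inl h)

variable (D)

/-- The monomial with exponent `m` is divisible by a generator of the edge ideal. -/
def DivisibleByEdge (m : V →₀ ℕ) : Prop := ∃ x y, D.arc x y ∧ 1 ≤ m x ∧ D.w y ≤ m y

theorem mem_edgeIdeal (K : Type*) [Field K] (f : MvPolynomial V K) :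
    f ∈ D.edgeIdeal K ↔ ∀ m ∈ f.support, D.DivisibleByEdge m := by
  classical
  have hgen : {f : MvPolynomial V K | ∃ x y, D.arc x y ∧ f = X x * X y ^ D.w y} =
      (fun s => monomial s 1) ''
        {s | ∃ x y, D.arc x y ∧ s = Finsupp.single x 1 + Finsupp.single y (D.w y)} := by
    have hmon (x y : V) : (X x * X y ^ D.w y : MvPolynomial V K) =
        monomial (Finsupp.single x 1 + Finsupp.single y (D.w y)) 1 := by
      rw [X_pow_eq_monomial, X, monomial_mul, one_mul]
    ext f
    constructor
    · rintro ⟨x, y, h, rfl⟩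
      exact ⟨_, ⟨x, y, h, rfl⟩, (hmon x y).symm⟩
    · rintro ⟨_, ⟨x, y, h, rfl⟩, rfl⟩
      exact ⟨x, y, h, (hmon x y).symm⟩
  rw [edgeIdeal, hgen, mem_ideal_span_monomial_image]
  refine forall₂_congr fun m _ => ?_
  constructor
  · rintro ⟨_, ⟨x, y, h, rfl⟩, hle⟩
    have hne := arc_ne h
    refine ⟨x, y, h, ?_, ?_⟩
    · simpa [Finsupp.single_apply, hne.symm] using hle x
    · simpa [Finsupp.single_apply, hne] using hle y
  · rintro ⟨x, y, h, hx, hy⟩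
    have hne := arc_ne h
    refine ⟨_, ⟨x, y, h, rfl⟩, fun z => ?_⟩
    simp only [Finsupp.add_apply, Finsupp.single_apply]
    split_ifs <;> grind

/-- The prime is the annihilator of one monomial. Its exponents are just too small for divisibility
by an edge: an arc ending at `y ∈ C` lacks a factor of `y`, and an arc leaving `C` lacks its source.
-/
theorem associatedPrimes_of_isStrongCover [Finite V] (K : Type*) [Field K] {C : Set V}
    (hC : D.IsStrongCover C) :
    Ideal.span (X '' C : Set (MvPolynomial V K)) ∈
      associatedPrimes (MvPolynomial V K) (MvPolynomial V K ⧸ D.edgeIdeal K) := by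
  classical
  rw [Ideal.mem_associatedPrimes_quotient_iff]
  refine ⟨isPrime_span_X_image C, ?_⟩
  obtain ⟨e, he⟩ : ∃ e : V →₀ ℕ, ∀ x, e x =
      if x ∈ C then if ∃ z, D.arc x z ∧ z ∉ C then 0 else D.w x - 1 else D.w x :=
    ⟨Finsupp.equivFunOnFinite.symm fun x =>
      if x ∈ C then if ∃ z, D.arc x z ∧ z ∉ C then 0 else D.w x - 1 else D.w x, fun _ => rfl⟩
  have hmul : ∀ h ∈ Ideal.span (X '' C : Set (MvPolynomial V K)),
      h * monomial e 1 ∈ D.edgeIdeal K := by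
    intro h hh
    rw [mem_edgeIdeal]
    intro m hm
    rw [mem_support_iff, coeff_mul_monomial', mul_one] at hm
    obtain ⟨hem, hm⟩ := ite_ne_right_iff.1 hm
    obtain ⟨z, hzC, hz⟩ := mem_ideal_span_X_image.1 hh _ (mem_support_iff.2 hm)
    rw [Finsupp.tsub_apply] at hz
    have hez : e z + 1 ≤ m z := by omega
    by_cases h1 : ∃ y, D.arc z y ∧ y ∉ C
    · obtain ⟨y, hy, hyC⟩ := h1
      refine ⟨z, y, hy, by omega, ?_⟩
      have := hem y
      rwa [he, if_neg hyC] at this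
    · rw [he, if_pos hzC, if_neg h1] at hez
      have hwz := D.one_le_w z
      by_cases h2 : ∃ y, D.arc y z ∧ y ∉ C
      · obtain ⟨y, hy, hyC⟩ := h2
        refine ⟨y, z, hy, ?_, by omega⟩
        have := hem y
        rw [he, if_neg hyC] at this
        exact (D.one_le_w y).trans this
      -- All neighbours of `z` lie in `C`. The strongness witness `y` has exponent `w y - 1 ≥ 1`, so
      -- the edge from `y` to `z` divides.
      · push Not at h1 h2
        obtain ⟨y, hyC, hyz, hwy, hy⟩ := hC.2 z hzC fun y hy =>
          ((D.adj_iff z y).1 hy).elim (h1 y) (h2 y)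
        refine ⟨y, z, hyz, ?_, by omega⟩
        have := hem y
        rw [he, if_pos hyC, if_neg (by push Not; exact hy)] at this
        omega
  refine ⟨monomial e 1, fun r => ⟨hmul r, fun hr => ?_⟩⟩
  refine mem_span_X_of_mul_mem (D.mem_edgeIdeal K) ?_ ?_ hmul hr
  · simp
  · intro m hm b hb
    obtain rfl : m = e := by
      by_contra hne
      rw [mem_support_iff, coeff_monomial, if_neg (Ne.symm hne)] at hm
      exact hm rfl
    rintro ⟨x, y, hxy, hx, hy⟩
    have hwy := D.one_le_w y
    rw [Finsupp.add_apply, he] at hx hy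
    by_cases hyC : y ∈ C
    · rw [hb y hyC, if_pos hyC] at hy
      split_ifs at hy <;> omega
    · have hxC : x ∈ C := (hC.1 (adj_of_arc hxy)).resolve_right hyC
      rw [hb x hxC, if_pos hxC, if_pos ⟨y, hxy, hyC⟩] at hx
      omega

/-- The polynomial `f` annihilated by `P` is normalised: multiplying it by a monomial outside `P`
and dropping terms in the edge ideal does not change its annihilator. A single term of the result
then shows that the variables in `P` form a strong cover. -/
theorem exists_isStrongCover_of_mem_associatedPrimes [Finite V] (K : Type*) [Field K]
    {P : Ideal (MvPolynomial V K)}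
    (hP : P ∈ associatedPrimes (MvPolynomial V K) (MvPolynomial V K ⧸ D.edgeIdeal K)) :
    ∃ C, D.IsStrongCover C ∧ P = Ideal.span (X '' C : Set (MvPolynomial V K)) := by
  classical
  obtain ⟨hprime, f, hf⟩ := Ideal.mem_associatedPrimes_quotient_iff.1 hP
  set C : Set V := {x | X x ∈ P}
  have hcov : D.G.IsVertexCover C := by
    have harc {x y : V} (h : D.arc x y) : x ∈ C ∨ y ∈ C := by
      have hmem : (X x * X y ^ D.w y : MvPolynomial V K) ∈ P :=
        (hf _).2 (Ideal.mul_mem_right _ _ (Ideal.subset_span ⟨x, y, h, rfl⟩))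
      exact (hprime.mem_or_mem hmem).imp id (hprime.mem_of_pow_mem _)
    intro x y hxy
    exact ((D.adj_iff x y).1 hxy).elim harc fun h => (harc h).symm
  -- This monomial raises the exponents outside `C` to the full weights, so that further factors
  -- outside `C` cannot create divisibility by an edge.
  obtain ⟨e, he⟩ : ∃ e : V →₀ ℕ, ∀ x, e x = if x ∈ C then 0 else D.w x :=
    ⟨Finsupp.equivFunOnFinite.symm fun x => if x ∈ C then 0 else D.w x, fun _ => rfl⟩
  have heP : monomial e (1 : K) ∉ P := by
    intro h
    obtain ⟨x, hx, hxP⟩ := exists_X_mem_of_monomial_mem hprime h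
    exact hx (by rw [he, if_pos (show x ∈ C from hxP)])
  obtain ⟨f₀, hf₀⟩ := exists_coeff_eq_ite (fun m => ¬ D.DivisibleByEdge m) (monomial e 1 * f)
  have hsub : monomial e 1 * f - f₀ ∈ D.edgeIdeal K := by
    rw [mem_edgeIdeal]
    intro m hm
    rw [mem_support_iff, coeff_sub, hf₀] at hm
    by_contra hcon
    rw [if_pos hcon, sub_self] at hm
    exact hm rfl
  have hPf₀ (r : MvPolynomial V K) : r ∈ P ↔ r * f₀ ∈ D.edgeIdeal K := by
    have h1 : r ∈ P ↔ r * (monomial e 1 * f) ∈ D.edgeIdeal K := by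
      rw [← mul_assoc, ← hf]
      exact ⟨fun h => P.mul_mem_right _ h, fun h => (hprime.mem_or_mem h).resolve_right heP⟩
    have h2 : r * (monomial e 1 * f) = r * f₀ + r * (monomial e 1 * f - f₀) := by ring
    rw [h1, h2, Ideal.add_mem_iff_left _ (Ideal.mul_mem_left _ _ hsub)]
  have hne : f₀ ≠ 0 := by
    rintro rfl
    exact hprime.ne_top ((Ideal.eq_top_iff_one P).2 ((hPf₀ 1).2 (by simp)))
  have hsupp : ∀ m ∈ f₀.support, ¬ D.DivisibleByEdge m ∧ ∀ x ∉ C, D.w x ≤ m x := by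
    intro m hm
    rw [mem_support_iff, hf₀] at hm
    obtain ⟨hdiv, hm⟩ := ite_ne_right_iff.1 hm
    rw [coeff_monomial_mul'] at hm
    refine ⟨hdiv, fun x hx => ?_⟩
    have := (ite_ne_right_iff.1 hm).1 x
    rwa [he, if_neg hx] at this
  have hPC : P = Ideal.span (X '' C : Set (MvPolynomial V K)) := by
    have hle : Ideal.span (X '' C : Set (MvPolynomial V K)) ≤ P := by
      rw [Ideal.span_le]
      rintro _ ⟨x, hx, rfl⟩
      exact hx
    refine le_antisymm (fun g hg => ?_) hle
    refine mem_span_X_of_mul_mem (D.mem_edgeIdeal K) hne ?_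
      (fun h hh => (hPf₀ h).1 (hle hh)) ((hPf₀ g).1 hg)
    rintro m hm b hb ⟨x, y, hxy, hx, hy⟩
    have hbig (z : V) (k : ℕ) (hk : k ≤ D.w z) (hz : k ≤ (b + m) z) : k ≤ m z := by
      by_cases hzC : z ∈ C
      · rwa [Finsupp.add_apply, hb z hzC, zero_add] at hz
      · exact hk.trans ((hsupp m hm).2 z hzC)
    exact (hsupp m hm).1 ⟨x, y, hxy, hbig x 1 (D.one_le_w x) hx, hbig y _ le_rfl hy⟩
  refine ⟨C, ⟨hcov, fun x hxC hxN => ?_⟩, hPC⟩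
  obtain ⟨m, hm⟩ := support_nonempty.mpr hne
  obtain ⟨hdiv, hbig⟩ := hsupp m hm
  -- Multiplication by `z ∈ C` makes the term `m` divisible by an edge; where that edge was not
  -- already satisfied by `m`, the end in question is `z`.
  have hstep {z : V} (hz : z ∈ C) :
      ∃ a b, D.arc a b ∧ (1 ≤ m a ∨ a = z) ∧ (D.w b ≤ m b ∨ b = z) := by
    have hmem : Finsupp.single z 1 + m ∈ (X z * f₀).support := by
      rw [mem_support_iff, coeff_X_mul]
      exact mem_support_iff.1 hm
    obtain ⟨a, b, hab, ha, hb⟩ := (D.mem_edgeIdeal K _).1 ((hPf₀ _).1 hz) _ hmem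
    refine ⟨a, b, hab, ?_, ?_⟩
    · by_cases h : a = z
      · exact Or.inr h
      · left; simpa [Finsupp.single_apply, Ne.symm h] using ha
    · by_cases h : b = z
      · exact Or.inr h
      · left; simpa [Finsupp.single_apply, Ne.symm h] using hb
  have hno {a b : V} (hab : D.arc a b) (ha : 1 ≤ m a) (hb : D.w b ≤ m b) : False :=
    hdiv ⟨a, b, hab, ha, hb⟩
  have hlow {z : V} (hz : z ∈ C) (h1 : 1 ≤ m z) : m z < D.w z := by
    by_contra! h2
    obtain ⟨a, b, hab, ha, hb⟩ := hstep hz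
    exact hno hab (ha.elim id fun h => h ▸ h1) (hb.elim id fun h => h ▸ h2)
  obtain ⟨a, b, hab, ha, hb⟩ := hstep hxC
  -- If the edge ends at `x`, its source `a` has exponent strictly between `0` and `w a`, so it is
  -- heavy, and an arc from `a` out of `C` would divide `m`. If not, it starts at `x`, and its end
  -- `b ∈ C` contradicts `hlow`.
  by_cases hbx : b = x
  · subst hbx
    have ha1 : 1 ≤ m a := ha.resolve_right (arc_ne hab)
    have haC : a ∈ C := hxN a (adj_of_arc hab).symm
    refine ⟨a, haC, hab, ha1.trans_lt (hlow haC ha1), fun z haz => ?_⟩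
    by_contra hzC
    exact hno haz ha1 (hbig z hzC)
  · exfalso
    have hb' := hb.resolve_right hbx
    have hbC : b ∈ C := by
      rcases ha with ha | rfl
      · exact (hno hab ha hb').elim
      · exact hxN b (adj_of_arc hab)
    exact absurd (hlow hbC ((D.one_le_w b).trans hb')) (not_lt.2 hb')

theorem isUnmixedIdeal_edgeIdeal_iff [Finite V] (K : Type*) [Field K] :
    (D.edgeIdeal K).IsUnmixedIdeal ↔
      ∀ C C', D.IsStrongCover C → D.IsStrongCover C' → C.encard = C'.encard := by
  constructor
  · intro h C C' hC hC'
    have := h _ (D.associatedPrimes_of_isStrongCover K hC) _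
      (D.associatedPrimes_of_isStrongCover K hC')
    rwa [height_span_X_image, height_span_X_image] at this
  · intro h P hP Q hQ
    obtain ⟨C, hC, rfl⟩ := D.exists_isStrongCover_of_mem_associatedPrimes K hP
    obtain ⟨C', hC', rfl⟩ := D.exists_isStrongCover_of_mem_associatedPrimes K hQ
    rw [height_span_X_image, height_span_X_image]
    exact h C C' hC hC'

end WeightedOrientedGraph

/-! ### From ⋆-semi-forests to strong covers. -/

namespace WeightedOrientedGraph

variable {V : Type*} {D : WeightedOrientedGraph V}

/-- `b` is reached from `a` along oriented edges of the subgraph `H`. -/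
def OrientedReach (H : D.G.Subgraph) : V → V → Prop :=
  Relation.ReflTransGen fun a b => H.Adj a b ∧ D.arc a b

theorem HasOrientedPath.orientedReach {H : D.G.Subgraph} {x y : V} (h : D.HasOrientedPath H x y) :
    OrientedReach H x y := by
  obtain ⟨p, -, hor, hle⟩ := h
  induction p with
  | nil => exact Relation.ReflTransGen.refl
  | @cons a b c hab p ih =>
    rw [SimpleGraph.Walk.toSubgraph, sup_le_iff] at hle
    refine Relation.ReflTransGen.head (b := b) ⟨hle.1.2 (by simp), ?_⟩ (ih ?_ hle.2)
    · exact hor ⟨(a, b), hab⟩ (by simp)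
    · exact fun d hd => hor d (by simp [hd])

theorem OrientedReach.hasOrientedPath {H : D.G.Subgraph} {x y : V} (h : OrientedReach H x y)
    (hx : x ∈ H.verts) : D.HasOrientedPath H x y := by
  classical
  obtain ⟨p, hor, hle⟩ : ∃ p : D.G.Walk x y, D.IsOriented p ∧ p.toSubgraph ≤ H := by
    induction h using Relation.ReflTransGen.head_induction_on with
    | refl =>
      exact ⟨SimpleGraph.Walk.nil, by simp [IsOriented], by simpa [SimpleGraph.Walk.toSubgraph]⟩
    | @head a b hab _ ih =>
      obtain ⟨p, hor, hle⟩ := ih (H.edge_vert hab.1.symm)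
      refine ⟨SimpleGraph.Walk.cons (H.adj_sub hab.1) p, ?_, ?_⟩
      · intro d hd
        rw [SimpleGraph.Walk.darts_cons, List.mem_cons] at hd
        rcases hd with rfl | hd
        · exact hab.2
        · exact hor d hd
      · rw [SimpleGraph.Walk.toSubgraph, sup_le_iff]
        exact ⟨SimpleGraph.subgraphOfAdj_le_of_adj H hab.1, hle⟩
  exact ⟨p.bypass, p.bypass_isPath, fun d hd => hor d (p.darts_bypass_subset_darts hd),
    SimpleGraph.Walk.toSubgraph_bypass_le_toSubgraph.trans hle⟩

theorem two_le_deg [Finite V] {H : D.G.Subgraph} {x a b : V} (ha : H.Adj x a) (hb : H.Adj x b)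
    (hab : a ≠ b) : 2 ≤ D.deg H x :=
  (Set.one_lt_ncard_iff (Set.toFinite _)).2 ⟨a, b, ha, hb, hab⟩

theorem one_le_deg [Finite V] {H : D.G.Subgraph} {x a : V} (ha : H.Adj x a) : 1 ≤ D.deg H x :=
  (Set.ncard_pos (Set.toFinite _)).2 ⟨a, ha⟩

/-- A vertex with an incoming and an outgoing arc in `H` has degree at least two. -/
theorem two_le_deg_of_arc [Finite V] {H : D.G.Subgraph} {x a b : V} (ha : H.Adj a x)
    (hax : D.arc a x) (hb : H.Adj x b) (hxb : D.arc x b) : 2 ≤ D.deg H x := by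
  refine two_le_deg ha.symm hb ?_
  rintro rfl
  exact D.arc_asymm _ _ hax hxb

theorem OrientedReach.exists_pred {H : D.G.Subgraph} {v x : V}
    (h : OrientedReach H v x) (hne : x ≠ v) :
    ∃ y, OrientedReach H v y ∧ H.Adj y x ∧ D.arc y x := by
  rcases Relation.ReflTransGen.cases_tail h with rfl | ⟨y, hy, hyx⟩
  · exact (hne rfl).elim
  · exact ⟨y, hy, hyx⟩

theorem IsOrientedCycle.exists_pred {C : D.G.Subgraph} (h : D.IsOrientedCycle C) {x : V}
    (hx : x ∈ C.verts) : ∃ y, C.Adj y x ∧ D.arc y x := by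
  classical
  obtain ⟨c, p, hp, hor, rfl⟩ := h
  rw [SimpleGraph.Walk.mem_verts_toSubgraph] at hx
  have hp' := hp.rotate hx
  have hor' : D.IsOriented (p.rotate x hx) := fun d hd =>
    hor d ((p.rotate_darts x hx).mem_iff.1 hd)
  rw [← SimpleGraph.Walk.toSubgraph_rotate p hx]
  generalize p.rotate x hx = q at hp' hor'
  have hq : ¬ q.Nil := hp'.not_nil
  have hmem := SimpleGraph.Walk.lastDart_mem_darts hq
  exact ⟨q.penultimate, (q.toSubgraph_adj_penultimate hq), hor' _ hmem⟩

theorem deg_eq_of_forall_adj {S H : D.G.Subgraph} (hle : S ≤ H) {x : V}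
    (h : ∀ y, H.Adj x y → S.Adj x y) : D.deg H x = D.deg S x := by
  have : H.neighborSet x = S.neighborSet x :=
    Set.ext fun y => ⟨fun hy => h y hy, fun hy => hle.2 hy⟩
  rw [deg, deg, this]

/-- The last arc of an oriented path from `v` to `x` starts at `v` or at a vertex that also has an
incoming arc. This source will witness strongness at `x`; `IsUnicycle.exists_pred` plays the same
role for unicycles. -/
theorem IsROT.exists_pred [Finite V] {T : D.G.Subgraph} {v x : V} (hT : D.IsROT T v)
    (hx : x ∈ T.verts) (hne : x ≠ v) :
    ∃ y, T.Adj y x ∧ D.arc y x ∧ (y = v ∨ 2 ≤ D.deg T y) := by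
  obtain ⟨y, hy, hyx, harc⟩ := (hT.2.2.1 x ⟨hx, hne⟩).orientedReach.exists_pred hne
  refine ⟨y, hyx, harc, or_iff_not_imp_left.2 fun hyv => ?_⟩
  obtain ⟨z, -, hzy, harc'⟩ := hy.exists_pred hyv
  exact two_le_deg_of_arc hzy harc' hyx harc

theorem IsUnicycle.exists_pred [Finite V] {B : D.G.Subgraph} {x : V} (hB : D.IsUnicycle B)
    (hx : x ∈ B.verts) : ∃ y, B.Adj y x ∧ D.arc y x ∧ 2 ≤ D.deg B y := by
  obtain ⟨C, hC, hor, hreach, -⟩ := hB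
  have hCB : C ≤ B := (hC.ge rfl : C ∈ D.cycles B).1
  have hcyc {y : V} (hy : y ∈ C.verts) {x : V} (hyx : B.Adj y x) (harc : D.arc y x) :
      2 ≤ D.deg B y := by
    obtain ⟨z, hz, hzarc⟩ := hor.exists_pred hy
    exact two_le_deg_of_arc (hCB.2 hz) hzarc hyx harc
  by_cases hxC : x ∈ C.verts
  · obtain ⟨y, hy, harc⟩ := hor.exists_pred hxC
    exact ⟨y, hCB.2 hy, harc, hcyc (C.edge_vert hy) (hCB.2 hy) harc⟩
  · obtain ⟨c, hc, hp⟩ := hreach x ⟨hx, hxC⟩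
    obtain ⟨y, hy, hyx, harc⟩ := hp.orientedReach.exists_pred (by rintro rfl; exact hxC hc)
    refine ⟨y, hyx, harc, ?_⟩
    by_cases hyc : y = c
    · exact hcyc (hyc ▸ hc) hyx harc
    · obtain ⟨z, -, hzy, harc'⟩ := hy.exists_pred hyc
      exact two_le_deg_of_arc hzy harc' hyx harc

/-- The vertices of a ⋆-semi-forest are contained in a strong vertex cover. -/
theorem IsStarSemiForest.exists_isStrongCover [Finite V] {H : D.G.Subgraph}
    (hH : D.IsStarSemiForest H) : ∃ C, D.IsStrongCover C ∧ H.verts ⊆ C := by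
  obtain ⟨r, t, T, v, B, hT, hB, rfl, hTT, hBB, hTB, u, hu, W₁, W₂, hW, hWd, hstab, hheavy, hW₂,
    hout⟩ := hH
  set H : D.G.Subgraph := (⨆ i, T i) ⊔ (⨆ j, B j) with hHdef
  have hTH (i) : T i ≤ H := (le_iSup T i).trans le_sup_left
  have hBH (j) : B j ≤ H := (le_iSup B j).trans le_sup_right
  have hadj {x y : V} (h : H.Adj x y) : (∃ i, (T i).Adj x y) ∨ ∃ j, (B j).Adj x y := by
    simpa [hHdef] using h
  have hverts {x : V} (h : x ∈ H.verts) : (∃ i, x ∈ (T i).verts) ∨ ∃ j, x ∈ (B j).verts := by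
    simpa [hHdef] using h
  have hdegT {i : Fin r} {x : V} (hx : x ∈ (T i).verts) : D.deg H x = D.deg (T i) x := by
    refine deg_eq_of_forall_adj (hTH i) fun y hy => ?_
    rcases hadj hy with ⟨k, hk⟩ | ⟨k, hk⟩
    · by_cases hik : i = k
      · exact hik ▸ hk
      · exact ((Set.disjoint_left.1 (hTT i k hik)) hx ((T k).edge_vert hk)).elim
    · exact ((Set.disjoint_left.1 (hTB i k)) hx ((B k).edge_vert hk)).elim
  have hdegB {j : Fin t} {x : V} (hx : x ∈ (B j).verts) : D.deg H x = D.deg (B j) x := by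
    refine deg_eq_of_forall_adj (hBH j) fun y hy => ?_
    rcases hadj hy with ⟨k, hk⟩ | ⟨k, hk⟩
    · exact ((Set.disjoint_left.1 (hTB k j)) ((T k).edge_vert hk) hx).elim
    · by_cases hjk : j = k
      · exact hjk ▸ hk
      · exact ((Set.disjoint_left.1 (hBB j k hjk)) hx ((B k).edge_vert hk)).elim
  have hsingle {i : Fin r} (h : (T i).verts = {v i}) : D.deg (T i) (v i) = 0 := by
    rw [deg, Set.ncard_eq_zero (Set.toFinite _), Set.eq_empty_iff_forall_notMem]
    intro y hy
    have h1 : (T i).Adj (v i) y := hy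
    have h2 : y ∈ (T i).verts := (T i).edge_vert h1.symm
    rw [h, Set.mem_singleton_iff] at h2
    exact (T i).loopless.irrefl _ (h2 ▸ h1)
  -- Vertices of weight one are non-parent leaves or isolated parents, neither of which belongs to
  -- `inner`.
  have hinner : ∀ x ∈ D.inner H v, 1 < D.w x := by
    intro x hx
    by_contra! hw
    have hw1 : D.w x = 1 := le_antisymm hw (D.one_le_w x)
    rcases hx with ⟨hxH, hdeg⟩ | ⟨i, rfl, hdeg⟩
    · rcases hverts hxH with ⟨i, hi⟩ | ⟨j, hj⟩
      · rw [hdegT hi] at hdeg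
        rcases (hT i).2.2.2 x hi hw1 with ⟨h, -⟩ | ⟨h, rfl⟩
        · omega
        · have := hsingle h
          omega
      · rw [hdegB hj] at hdeg
        obtain ⟨C, -, -, -, h⟩ := hB j
        have := h x hj hw1
        omega
    · rw [hdegT (hT i).1] at hdeg
      rcases (hT i).2.2.2 _ (hT i).1 hw1 with ⟨-, h⟩ | ⟨h, -⟩
      · exact h rfl
      · have := hsingle h
        omega
  have hpred : ∀ x ∈ H.verts, (∃ i, x = v i) ∨ ∃ y ∈ D.inner H v, D.arc y x := by
    intro x hx
    rcases hverts hx with ⟨i, hi⟩ | ⟨j, hj⟩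
    · refine or_iff_not_imp_left.2 fun hne => ?_
      push Not at hne
      obtain ⟨y, hyx, harc, hy⟩ := (hT i).exists_pred hi (hne i)
      have hyT := (T i).edge_vert hyx
      refine ⟨y, ?_, harc⟩
      rcases hy with rfl | hy
      · have h1 : 1 ≤ D.deg (T i) (v i) := one_le_deg hyx
        rw [← hdegT hyT] at h1
        rcases h1.eq_or_lt with h1 | h1
        · exact Or.inr ⟨i, rfl, h1.symm⟩
        · exact Or.inl ⟨(hTH i).1 hyT, h1⟩
      · exact Or.inl ⟨(hTH i).1 hyT, (hdegT hyT).symm ▸ hy⟩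
    · obtain ⟨y, hyx, harc, hy⟩ := (hB j).exists_pred hj
      have hyB := (B j).edge_vert hyx
      exact Or.inr ⟨y, Or.inl ⟨(hBH j).1 hyB, (hdegB hyB).symm ▸ hy⟩, harc⟩
  set A : Set V := H.verts ∪ {z | ∃ x ∈ W₂ ∪ D.inner H v, D.arc x z} with hA
  have hstart : D.G.IsVertexCover W₁ᶜ ∧ A ⊆ W₁ᶜ := by
    refine ⟨SimpleGraph.isVertexCover_compl.2 hstab, ?_⟩
    rintro z (hz | ⟨x, hx, hxz⟩) hzW
    · obtain ⟨i, rfl⟩ : z ∈ Set.range u := hW ▸ Or.inl hzW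
      exact (hu i).1 hz
    · exact hout x hx z hzW hxz
  -- `C` is minimal among the covers containing `A`. A vertex of `C` outside `A` therefore has a
  -- neighbour outside `C`, so strongness needs checking only on `A`.
  obtain ⟨C, hCW, ⟨hcov, hAC⟩, hmin⟩ := exists_minimal_le_of_wellFoundedLT
    (fun S : Set V => D.G.IsVertexCover S ∧ A ⊆ S) W₁ᶜ hstart
  refine ⟨C, ⟨hcov, fun x hx hN => ?_⟩, Set.subset_union_left.trans hAC⟩
  have hgood (h : ∃ y ∈ W₂ ∪ D.inner H v, D.arc y x) :
      ∃ y ∈ C, D.arc y x ∧ 1 < D.w y ∧ ∀ z, D.arc y z → z ∈ C := by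
    obtain ⟨y, hy, hyx⟩ := h
    exact ⟨y, hN y (adj_of_arc hyx).symm, hyx, hy.elim (fun h => hheavy h) (hinner y),
      fun z hz => hAC (Or.inr ⟨y, hy, hz⟩)⟩
  by_cases hxA : x ∈ A
  · rcases hxA with hxH | hx'
    · rcases hpred x hxH with ⟨i, rfl⟩ | ⟨y, hy, hyx⟩
      -- All neighbours of the parent `v i` lie in `C`, which avoids `W₁`; so `u i` lies in `W₂` and
      -- is itself the witness.
      · have hui : u i ∈ W₁ ∪ W₂ := hW ▸ Set.mem_range_self i
        rcases hui with h1 | h2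
        · exact (hCW (hN _ (hu i).2) h1).elim
        · exact hgood ⟨u i, Or.inl h2, hW₂ i h2⟩
      · exact hgood ⟨y, Or.inr hy, hyx⟩
    · exact hgood hx'
  · have hsmall : D.G.IsVertexCover (C \ {x}) ∧ A ⊆ C \ {x} := by
      refine ⟨fun a b hab => ?_, fun a ha => ⟨hAC ha, fun h => hxA (h ▸ ha)⟩⟩
      by_cases hax : a = x
      · subst hax
        exact Or.inr ⟨hN b hab, hab.ne'⟩
      · by_cases hbx : b = x
        · subst hbx
          exact Or.inl ⟨hN a hab.symm, hax⟩
        · exact (hcov hab).imp (fun h => ⟨h, hax⟩) fun h => ⟨h, hbx⟩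
    exact ((hmin hsmall Set.sdiff_subset hx).2 rfl).elim

/-! ### From strong covers to ⋆-semi-forests, by parent functions. -/

variable (D) in
/-- The subgraph on `S` whose oriented edges are the arcs from `q x` to `x`. -/
def parentSubgraph (q : V → V) (S : Set V) : D.G.Subgraph where
  verts := S
  Adj a b := a ∈ S ∧ b ∈ S ∧ ((D.arc a b ∧ q b = a) ∨ (D.arc b a ∧ q a = b))
  adj_sub h := (D.adj_iff _ _).2 (h.2.2.imp And.left And.left)
  edge_vert h := h.1
  symm := ⟨fun _ _ h => ⟨h.2.1, h.1, h.2.2.symm⟩⟩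

theorem parentSubgraph_mono (q : V → V) {S S' : Set V} (h : S ⊆ S') :
    D.parentSubgraph q S ≤ D.parentSubgraph q S' :=
  ⟨h, fun _ _ hab => ⟨h hab.1, h hab.2.1, hab.2.2⟩⟩

/-- A cycle of `parentSubgraph q S` is closed under `q`, which is injective on it. -/
theorem arc_of_mem_cycle [Finite V] {q : V → V} {S : Set V} {x : V} {p : D.G.Walk x x}
    (hp : p.IsCycle) (hle : p.toSubgraph ≤ D.parentSubgraph q S) :
    (∀ v ∈ p.toSubgraph.verts, D.arc (q v) v ∧ p.toSubgraph.Adj (q v) v) ∧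
      Set.InjOn q p.toSubgraph.verts := by
  -- Of the two cycle neighbours of `v`, at most one is its parent `q v`, so another is a child.
  -- Choosing children is injective, hence bijective on the finite cycle, and `q` is its inverse.
  have hchild (v : p.toSubgraph.verts) : ∃ z : p.toSubgraph.verts,
      p.toSubgraph.Adj v z ∧ q z = v ∧ D.arc v z := by
    obtain ⟨v, hv⟩ := v
    have h2 := hp.ncard_neighborSet_toSubgraph_eq_two (p.mem_verts_toSubgraph.1 hv)
    obtain ⟨a, b, ha, hb, hab⟩ :=
      (Set.one_lt_ncard_iff (Set.toFinite (p.toSubgraph.neighborSet v))).1 (by omega)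
    have ha' : p.toSubgraph.Adj v a := ha
    have hb' : p.toSubgraph.Adj v b := hb
    rcases (hle.2 ha').2.2 with h | h
    · exact ⟨⟨a, p.toSubgraph.edge_vert ha'.symm⟩, ha', h.2, h.1⟩
    · rcases (hle.2 hb').2.2 with h' | h'
      · exact ⟨⟨b, p.toSubgraph.edge_vert hb'.symm⟩, hb', h'.2, h'.1⟩
      · exact (hab (h.2.symm.trans h'.2)).elim
  choose ch hadj hq harc using hchild
  have hinj : Function.Injective ch := fun a b hab =>
    Subtype.ext (by rw [← hq a, ← hq b, hab])
  have hsurj : Function.Surjective ch := Finite.surjective_of_injective hinj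
  constructor
  · intro v hv
    obtain ⟨z, hz⟩ := hsurj ⟨v, hv⟩
    have h1 := hq z
    have h2 := hadj z
    have h3 := harc z
    rw [hz] at h1 h2 h3
    rw [h1]
    exact ⟨h3, h2⟩
  · intro v hv v' hv' h
    obtain ⟨z, hz⟩ := hsurj ⟨v, hv⟩
    obtain ⟨z', hz'⟩ := hsurj ⟨v', hv'⟩
    have h1 := hq z
    have h1' := hq z'
    rw [hz] at h1
    rw [hz'] at h1'
    have : z = z' := Subtype.ext (h1.symm.trans (h.trans h1'))
    subst this
    exact congrArg Subtype.val (hz.symm.trans hz')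

/-- Hypotheses on a parent function: `S` is closed under `q`, and for each `x` which is not a fixed
point, `q x` is a vertex of weight greater than one with an arc to `x`. -/
structure IsParentFunction (D : WeightedOrientedGraph V) (q : V → V) (S : Set V) : Prop where
  mapsTo : Set.MapsTo q S S
  arc : ∀ x ∈ S, q x ≠ x → D.arc (q x) x
  heavy : ∀ x ∈ S, q x ≠ x → 1 < D.w (q x)

theorem IsParentFunction.iterate_mem {q : V → V} {S : Set V} (h : D.IsParentFunction q S) {x : V}
    (hx : x ∈ S) (n : ℕ) : q^[n] x ∈ S := h.mapsTo.iterate n hx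

theorem IsParentFunction.orientedReach {q : V → V} {S : Set V} (h : D.IsParentFunction q S)
    (n : ℕ) {x : V} (hx : x ∈ S) : OrientedReach (D.parentSubgraph q S) (q^[n] x) x := by
  induction n generalizing x with
  | zero => exact Relation.ReflTransGen.refl
  | succ n ih =>
    have hq := h.mapsTo hx
    have h1 := ih hq
    rw [Function.iterate_succ_apply]
    by_cases hfix : q x = x
    · rwa [hfix] at h1 ⊢
    · have harc := h.arc x hx hfix
      exact Relation.ReflTransGen.tail h1 ⟨⟨hq, hx, Or.inl ⟨harc, rfl⟩⟩, harc⟩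

theorem IsParentFunction.deg_eq_one {q : V → V} {S : Set V} (h : D.IsParentFunction q S) {x : V}
    (hx : x ∈ S) (hfix : q x ≠ x) (hw : D.w x = 1) : D.deg (D.parentSubgraph q S) x = 1 := by
  have : (D.parentSubgraph q S).neighborSet x = {q x} := by
    ext y
    constructor
    · rintro ⟨-, hy, ⟨harc, hyx⟩ | ⟨-, hxy⟩⟩
      · have := h.heavy y hy (by rw [hyx]; exact arc_ne harc)
        rw [hyx] at this
        omega
      · exact hxy.symm
    · rintro rfl
      exact ⟨hx, h.mapsTo hx, Or.inr ⟨h.arc x hx hfix, rfl⟩⟩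
  rw [deg, this, Set.ncard_singleton]

/-- A cycle would be closed under `q`, hence contain the fixed point `r`, which has no arc from its
own parent. If `r` has weight one it can have no child, since parents of other vertices are heavy,
and so `S = {r}`. -/
theorem IsParentFunction.isROT [Finite V] {q : V → V} {S : Set V} (h : D.IsParentFunction q S)
    {r : V} (hr : r ∈ S) (hfix : q r = r) (hS : ∀ x ∈ S, ∃ n, q^[n] x = r) :
    D.IsROT (D.parentSubgraph q S) r := by
  have hrfix (n : ℕ) : q^[n] r = r := Function.iterate_fixed hfix n
  have hne {x : V} (hx : x ∈ S) (hxr : x ≠ r) : q x ≠ x := by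
    intro hx'
    obtain ⟨n, hn⟩ := hS x hx
    rw [Function.iterate_fixed hx'] at hn
    exact hxr hn
  refine ⟨hr, ?_, ?_, ?_⟩
  · rw [Set.eq_empty_iff_forall_notMem]
    rintro C ⟨hle, c, p, hp, rfl⟩
    obtain ⟨hclosed, -⟩ := arc_of_mem_cycle hp hle
    have hmaps : Set.MapsTo q p.toSubgraph.verts p.toSubgraph.verts := fun v hv =>
      p.toSubgraph.edge_vert (hclosed v hv).2
    have hc : c ∈ p.toSubgraph.verts := p.start_mem_verts_toSubgraph
    obtain ⟨n, hn⟩ := hS c (hle.1 hc)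
    have hrC : r ∈ p.toSubgraph.verts := hn ▸ hmaps.iterate n hc
    exact arc_ne (hclosed r hrC).1 hfix
  · rintro x ⟨hx, -⟩
    obtain ⟨n, hn⟩ := hS x hx
    have := h.orientedReach n hx
    rw [hn] at this
    exact this.hasOrientedPath hr
  · intro x hx hw
    by_cases hxr : x = r
    · right
      refine ⟨Set.eq_singleton_iff_unique_mem.2 ⟨hr, fun y hy => ?_⟩, hxr⟩
      by_contra hyr
      obtain ⟨n, hn⟩ := hS y hy
      induction n generalizing y with
      | zero => exact hyr hn
      | succ n ih =>
        rw [Function.iterate_succ_apply] at hn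
        by_cases hqy : q y = r
        · have := h.heavy y hy (hne hy hyr)
          rw [hqy, ← hxr, hw] at this
          omega
        · exact ih (q y) (h.mapsTo hy) hqy hn
    · exact Or.inl ⟨h.deg_eq_one hx (hne hx hxr) hw, hxr⟩

/-- `q` permutes the vertices of each cycle, and any two orbits meet. Following `q` from a vertex of
one cycle thus enters the other and returns to the start, so the vertex sets agree; the edges are
then determined by `q`. -/
theorem cycle_eq_of_iterate_eq [Finite V] {q : V → V} {S : Set V}
    (hS : ∀ x ∈ S, ∀ y ∈ S, ∃ m n, q^[m] x = q^[n] y) {C C' : D.G.Subgraph}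
    (hC : C ∈ D.cycles (D.parentSubgraph q S)) (hC' : C' ∈ D.cycles (D.parentSubgraph q S)) :
    C = C' := by
  obtain ⟨hle, c, p, hp, rfl⟩ := hC
  obtain ⟨hle', c', p', hp', rfl⟩ := hC'
  have hsub {c c' : V} {p : D.G.Walk c c} {p' : D.G.Walk c' c'} (hp : p.IsCycle)
      (hp' : p'.IsCycle) (hle : p.toSubgraph ≤ D.parentSubgraph q S)
      (hle' : p'.toSubgraph ≤ D.parentSubgraph q S) : p.toSubgraph.verts ⊆ p'.toSubgraph.verts := by
    intro v hv
    obtain ⟨hclosed, hinj⟩ := arc_of_mem_cycle hp hle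
    obtain ⟨hclosed', -⟩ := arc_of_mem_cycle hp' hle'
    have hmaps : Set.MapsTo q p.toSubgraph.verts p.toSubgraph.verts := fun v hv =>
      p.toSubgraph.edge_vert (hclosed v hv).2
    have hmaps' : Set.MapsTo q p'.toSubgraph.verts p'.toSubgraph.verts := fun v hv =>
      p'.toSubgraph.edge_vert (hclosed' v hv).2
    have hc' : c' ∈ p'.toSubgraph.verts := p'.start_mem_verts_toSubgraph
    obtain ⟨m, n, hmn⟩ := hS v (hle.1 hv) c' (hle'.1 hc')
    have hper := (hmaps.restrict_inj.2 hinj).mem_periodicPts ⟨v, hv⟩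
    obtain ⟨k, hk, hkv⟩ := hper
    have hkv' : q^[k] v = v := by
      have := congrArg Subtype.val hkv
      rwa [Set.MapsTo.iterate_restrict] at this
    -- A multiple of the period `k` that is at least `m`, so that the way back to `v` passes through
    -- the meeting point `q^[m] v`.
    have hmul : q^[k * m] v = v := by
      rw [Function.iterate_mul]
      exact Function.iterate_fixed hkv' m
    obtain ⟨l, hl⟩ : ∃ l, k * m = l + m := ⟨k * m - m, by
      have := Nat.le_mul_of_pos_left m hk
      omega⟩
    rw [hl, Function.iterate_add_apply, hmn] at hmul
    rw [← hmul]
    exact hmaps'.iterate l (hmaps'.iterate n hc')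
  have hverts := (hsub hp hp' hle hle').antisymm (hsub hp' hp hle' hle)
  have hadj {c c' : V} {p : D.G.Walk c c} {p' : D.G.Walk c' c'} (hp' : p'.IsCycle)
      (hle : p.toSubgraph ≤ D.parentSubgraph q S) (hle' : p'.toSubgraph ≤ D.parentSubgraph q S)
      (hverts : p.toSubgraph.verts = p'.toSubgraph.verts) {a b : V} (hab : p.toSubgraph.Adj a b) :
      p'.toSubgraph.Adj a b := by
    have ha := p.toSubgraph.edge_vert hab
    have hb := p.toSubgraph.edge_vert hab.symm
    rw [hverts] at ha hb
    obtain ⟨hclosed', -⟩ := arc_of_mem_cycle hp' hle'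
    rcases (hle.2 hab).2.2 with h | h
    · have := (hclosed' b hb).2
      rwa [h.2] at this
    · have := (hclosed' a ha).2
      rw [h.2] at this
      exact this.symm
  refine SimpleGraph.Subgraph.ext hverts ?_
  ext a b
  exact ⟨hadj hp' hle hle' hverts, hadj hp hle' hle hverts.symm⟩

/-- A finite orbit contains a periodic vertex `c`. Arcs run from parent to child, so the orbit read
backwards is an oriented path from `c` to `q c`, closed up by the arc from `q c` to `c`. -/
theorem IsParentFunction.isUnicycle [Finite V] {q : V → V} {S : Set V}
    (h : D.IsParentFunction q S) (hne : S.Nonempty) (hfix : ∀ x ∈ S, q x ≠ x)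
    (hS : ∀ x ∈ S, ∀ y ∈ S, ∃ m n, q^[m] x = q^[n] y) :
    D.IsUnicycle (D.parentSubgraph q S) := by
  obtain ⟨x₀, hx₀⟩ := hne
  obtain ⟨c, hc, k, hk⟩ : ∃ c ∈ S, ∃ k, q^[k] (q c) = c := by
    obtain ⟨m, n, hmn, hmneq⟩ := Finite.exists_ne_map_eq_of_infinite fun n : ℕ => q^[n] x₀
    wlog hlt : m < n generalizing m n
    · exact this n m hmn.symm hmneq.symm (by omega)
    refine ⟨q^[m] x₀, h.iterate_mem hx₀ m, n - m - 1, ?_⟩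
    have hmneq' : q^[m] x₀ = q^[n] x₀ := hmneq
    rw [← Function.iterate_succ_apply, ← Function.iterate_add_apply,
      show (n - m - 1).succ + m = n by omega, hmneq']
  have hqc := h.mapsTo hc
  have harc := h.arc c hc (hfix c hc)
  obtain ⟨p, hp, hor, hle⟩ : D.HasOrientedPath (D.parentSubgraph q S) c (q c) := by
    have := h.orientedReach k hqc
    rw [hk] at this
    exact this.hasOrientedPath hc
  have hadj : D.G.Adj (q c) c := adj_of_arc harc
  have hcyc : (SimpleGraph.Walk.cons hadj p).IsCycle := by
    rw [SimpleGraph.Walk.cons_isCycle_iff]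
    refine ⟨hp, fun hmem => ?_⟩
    -- If the path used the closing edge, it would enter `c`, its own starting point.
    obtain ⟨d, hd, hde⟩ := List.mem_map.1 hmem
    have hdarc := hor d hd
    have hsnd : d.snd = c := by
      rw [SimpleGraph.dart_edge_eq_mk'_iff'] at hde
      rcases hde with ⟨-, h2⟩ | ⟨h1, h2⟩
      · exact h2
      · rw [h1, h2] at hdarc
        exact (D.arc_asymm _ _ harc hdarc).elim
    have hnodup := hp.support_nodup
    rw [← p.cons_map_snd_darts, List.nodup_cons] at hnodup
    exact hnodup.1 (List.mem_map.2 ⟨d, hd, hsnd⟩)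
  have hcle : (SimpleGraph.Walk.cons hadj p).toSubgraph ≤ D.parentSubgraph q S := by
    rw [SimpleGraph.Walk.toSubgraph, sup_le_iff]
    exact ⟨SimpleGraph.subgraphOfAdj_le_of_adj (D.parentSubgraph q S)
      ⟨hqc, hc, Or.inl ⟨harc, rfl⟩⟩, hle⟩
  have hmem : (SimpleGraph.Walk.cons hadj p).toSubgraph ∈ D.cycles (D.parentSubgraph q S) :=
    ⟨hcle, _, _, hcyc, rfl⟩
  refine ⟨_, Set.eq_singleton_iff_unique_mem.2
    ⟨hmem, fun C hC => cycle_eq_of_iterate_eq hS hC hmem⟩,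
    ⟨_, _, hcyc, fun d hd => ?_, rfl⟩, ?_, fun x hx hw => h.deg_eq_one hx (hfix x hx) hw⟩
  · rw [SimpleGraph.Walk.darts_cons, List.mem_cons] at hd
    rcases hd with rfl | hd
    · exact harc
    · exact hor d hd
  · rintro y ⟨hy, -⟩
    obtain ⟨m, n, hmn⟩ := hS y hy c hc
    have hmaps : Set.MapsTo q (SimpleGraph.Walk.cons hadj p).toSubgraph.verts
        (SimpleGraph.Walk.cons hadj p).toSubgraph.verts := fun v hv =>
      SimpleGraph.Subgraph.edge_vert _ ((arc_of_mem_cycle hcyc hcle).1 v hv).2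
    refine ⟨q^[m] y, ?_, (h.orientedReach m hy).hasOrientedPath (h.iterate_mem hy m)⟩
    rw [hmn]
    refine hmaps.iterate n ?_
    rw [SimpleGraph.Walk.mem_verts_toSubgraph]
    simp

/-- An induced subgraph whose vertices lie in a strong vertex cover has a generating
⋆-semi-forest. -/
theorem IsStrongCover.hasGeneratingStarSemiForest [Finite V] {C : Set V} (hC : D.IsStrongCover C)
    {K : D.G.Subgraph} (hK : K.verts ⊆ C) : D.HasGeneratingStarSemiForest K := by
  classical
  -- `p` is the future parent of `x`: a strongness witness inside `K` if one is found, otherwise `x`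
  -- itself. In the latter case `u` is a neighbour outside `C`, or a witness in `C` outside `K`.
  have hex (x : V) : ∃ p u, x ∈ K.verts →
      (p ∈ K.verts ∧ D.arc p x ∧ 1 < D.w p ∧ ∀ z, D.arc p z → z ∈ C) ∨
      (p = x ∧ u ∉ K.verts ∧ D.G.Adj x u ∧
        (u ∈ C → D.arc u x ∧ 1 < D.w u ∧ ∀ z, D.arc u z → z ∈ C)) := by
    by_cases hN : ∀ y, D.G.Adj x y → y ∈ C
    · by_cases hx : x ∈ K.verts
      · obtain ⟨y, hyC, hyx, hw, hy⟩ := hC.2 x (hK hx) hN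
        by_cases hyK : y ∈ K.verts
        · exact ⟨y, y, fun _ => Or.inl ⟨hyK, hyx, hw, hy⟩⟩
        · exact ⟨x, y, fun _ => Or.inr ⟨rfl, hyK, (adj_of_arc hyx).symm, fun _ => ⟨hyx, hw, hy⟩⟩⟩
      · exact ⟨x, x, fun h => (hx h).elim⟩
    · push Not at hN
      obtain ⟨y, hxy, hyC⟩ := hN
      exact ⟨x, y, fun _ => Or.inr ⟨rfl, fun h => hyC (hK h), hxy, fun h => (hyC h).elim⟩⟩
  choose q u hqu using hex
  have hpar {x : V} (hx : x ∈ K.verts) (hfix : q x ≠ x) :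
      q x ∈ K.verts ∧ D.arc (q x) x ∧ 1 < D.w (q x) ∧ ∀ z, D.arc (q x) z → z ∈ C :=
    (hqu x hx).resolve_right fun h => hfix h.1
  have hroot {x : V} (hx : x ∈ K.verts) (hfix : q x = x) : u x ∉ K.verts ∧ D.G.Adj x (u x) ∧
      (u x ∈ C → D.arc (u x) x ∧ 1 < D.w (u x) ∧ ∀ z, D.arc (u x) z → z ∈ C) :=
    ((hqu x hx).resolve_left fun h => arc_ne h.2.1 hfix).2
  have hmaps : Set.MapsTo q K.verts K.verts := fun x hx => by
    by_cases h : q x = x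
    · rwa [h]
    · exact (hpar hx h).1
  have hfun {S : Set V} (hS : S ⊆ K.verts) (hm : Set.MapsTo q S S) : D.IsParentFunction q S :=
    ⟨hm, fun x hx h => (hpar (hS hx) h).2.1, fun x hx h => (hpar (hS hx) h).2.2.1⟩
  -- A component of the functional graph of `q` either has a fixed point and is a tree rooted there,
  -- or has none and is a unicycle.
  let Root := {r : V // r ∈ K.verts ∧ q r = r}
  let treeSet : V → Set V := fun r => {x | x ∈ K.verts ∧ ∃ n, q^[n] x = r}
  let compSet : V → Set V := fun x => {y | y ∈ K.verts ∧ ∃ m n, q^[m] y = q^[n] x}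
  let Cyc := {S : Set V // ∃ x ∈ K.verts, (∀ n, q (q^[n] x) ≠ q^[n] x) ∧ S = compSet x}
  have htree (r : Root) : D.IsParentFunction q (treeSet r.1) := by
    refine hfun (fun x hx => hx.1) ?_
    rintro x ⟨hx, n, hn⟩
    refine ⟨hmaps hx, n, ?_⟩
    rw [← Function.iterate_succ_apply, Function.iterate_succ_apply', hn, r.2.2]
  have hcomp (x : V) : D.IsParentFunction q (compSet x) := by
    refine hfun (fun x hx => hx.1) ?_
    rintro y ⟨hy, m, n, hmn⟩
    refine ⟨hmaps hy, m, n + 1, ?_⟩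
    rw [← Function.iterate_succ_apply, Function.iterate_succ_apply', hmn,
      Function.iterate_succ_apply']
  have hstable {y : V} {m : ℕ} (hy : q (q^[m] y) = q^[m] y) {k : ℕ} (hk : m ≤ k) :
      q^[k] y = q^[m] y := by
    obtain ⟨l, rfl⟩ := Nat.exists_eq_add_of_le' hk
    rw [Function.iterate_add_apply, Function.iterate_fixed hy]
  have hcompfix {x y : V} (hx : ∀ n, q (q^[n] x) ≠ q^[n] x) (hy : y ∈ compSet x) (k : ℕ) :
      q (q^[k] y) ≠ q^[k] y := by
    obtain ⟨-, m, n, hmn⟩ := hy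
    intro hk
    refine hx (k + n) ?_
    rw [Function.iterate_add_apply, ← hmn, ← Function.iterate_add_apply,
      hstable hk (Nat.le_add_right k m), hk]
  have hcompjoin {x y z : V} (hy : y ∈ compSet x) (hz : z ∈ compSet x) :
      ∃ m n, q^[m] y = q^[n] z := by
    obtain ⟨-, m, n, hmn⟩ := hy
    obtain ⟨-, m', n', hmn'⟩ := hz
    refine ⟨n' + m, n + m', ?_⟩
    rw [Function.iterate_add_apply, hmn, Function.iterate_add_apply, hmn',
      ← Function.iterate_add_apply, ← Function.iterate_add_apply, add_comm]
  obtain ⟨r, ⟨er⟩⟩ := Finite.exists_equiv_fin Root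
  obtain ⟨t, ⟨et⟩⟩ := Finite.exists_equiv_fin Cyc
  let T : Fin r → D.G.Subgraph := fun i => D.parentSubgraph q (treeSet (er.symm i).1)
  let v : Fin r → V := fun i => (er.symm i).1
  let B : Fin t → D.G.Subgraph := fun j => D.parentSubgraph q (et.symm j).1
  have hv (i) : v i ∈ K.verts ∧ q (v i) = v i := (er.symm i).2
  set H : D.G.Subgraph := (⨆ i, T i) ⊔ (⨆ j, B j) with hH
  have hverts : K.verts = H.verts := by
    ext x
    have hmem : x ∈ H.verts ↔ (∃ i, x ∈ (T i).verts) ∨ ∃ j, x ∈ (B j).verts := by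
      simp [hH]
    rw [hmem]
    constructor
    · intro hx
      by_cases hn : ∃ n, q (q^[n] x) = q^[n] x
      · obtain ⟨n, hn⟩ := hn
        left
        refine ⟨er ⟨q^[n] x, hmaps.iterate n hx, hn⟩, ?_⟩
        change x ∈ treeSet _
        rw [Equiv.symm_apply_apply]
        exact ⟨hx, n, rfl⟩
      · push Not at hn
        right
        refine ⟨et ⟨compSet x, x, hx, hn, rfl⟩, ?_⟩
        change x ∈ (et.symm _).1
        rw [Equiv.symm_apply_apply]
        exact ⟨hx, 0, 0, rfl⟩
    · rintro (⟨i, hi⟩ | ⟨j, hj⟩)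
      · exact hi.1
      · obtain ⟨y, -, -, hS⟩ := (et.symm j).2
        have hj' : x ∈ (et.symm j).1 := hj
        rw [hS] at hj'
        exact hj'.1
  have hHle : H ≤ D.parentSubgraph q K.verts := by
    refine sup_le (iSup_le fun i => parentSubgraph_mono q fun x hx => hx.1)
      (iSup_le fun j => parentSubgraph_mono q ?_)
    obtain ⟨y, -, -, hS⟩ := (et.symm j).2
    rw [hS]
    exact fun x hx => hx.1
  have hchild {x : V} (hx : ∃ z ∈ K.verts, D.arc x z ∧ q z = x) (y : V) (hxy : D.arc x y) :
      y ∈ C := by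
    obtain ⟨z, hz, hxz, hqz⟩ := hx
    refine (hpar hz ?_).2.2.2 y (hqz.symm ▸ hxy)
    rw [hqz]
    exact arc_ne hxz
  -- Every vertex of `inner` has a child: only one neighbour can be its parent, and a root has no
  -- parent but itself. So by `hchild` all its arcs end in `C`.
  have hinner : ∀ x ∈ D.inner H v, ∃ z ∈ K.verts, D.arc x z ∧ q z = x := by
    rintro x (⟨-, hdeg⟩ | ⟨i, rfl, hdeg⟩)
    · obtain ⟨a, b, ha, hb, hab⟩ := (Set.one_lt_ncard_iff (Set.toFinite (H.neighborSet x))).1 hdeg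
      obtain ⟨-, haK, ha⟩ := hHle.2 ha
      obtain ⟨-, hbK, hb⟩ := hHle.2 hb
      rcases ha with ha | ha
      · exact ⟨a, haK, ha⟩
      · rcases hb with hb | hb
        · exact ⟨b, hbK, hb⟩
        · exact (hab (ha.2.symm.trans hb.2)).elim
    · obtain ⟨a, ha⟩ := (Set.ncard_pos (Set.toFinite (H.neighborSet (v i)))).1
        (show 0 < D.deg H (v i) by omega)
      obtain ⟨-, haK, ha | ha⟩ := hHle.2 ha
      · exact ⟨a, haK, ha⟩
      · exact (arc_ne ha.1 (ha.2.symm.trans (hv i).2)).elim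
  -- `W₁` and `W₂` are the chosen neighbours outside and inside `C`; `W₁` is stable because `C` is a
  -- cover.
  refine ⟨H, ⟨r, t, T, v, B, ?_, ?_, rfl, ?_, ?_, ?_, fun i => u (v i), ?_,
    Set.range (fun i => u (v i)) ∩ Cᶜ, Set.range (fun i => u (v i)) ∩ C, ?_, ?_, ?_, ?_, ?_, ?_⟩,
    hverts⟩
  · exact fun i => (htree _).isROT ⟨(hv i).1, 0, rfl⟩ (hv i).2 fun x hx => hx.2
  · intro j
    obtain ⟨x, hx, hfix, hS⟩ := (et.symm j).2
    change D.IsUnicycle (D.parentSubgraph q (et.symm j).1)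
    rw [hS]
    exact (hcomp x).isUnicycle ⟨x, hx, 0, 0, rfl⟩ (fun y hy => hcompfix hfix hy 0)
      fun y hy z hz => hcompjoin hy hz
  · intro i i' hne
    rw [Set.disjoint_left]
    rintro x ⟨-, n, hn⟩ ⟨-, n', hn'⟩
    refine hne (er.symm.injective (Subtype.ext ?_))
    have h1 := hstable (y := x) (m := n) (by rw [hn]; exact (hv i).2) (le_max_left n n')
    have h2 := hstable (y := x) (m := n') (by rw [hn']; exact (hv i').2) (le_max_right n n')
    rw [← hn, ← hn', ← h1, ← h2]
  · intro j j' hne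
    obtain ⟨x, hx, hfix, hS⟩ := (et.symm j).2
    obtain ⟨x', hx', hfix', hS'⟩ := (et.symm j').2
    have key {x x' z : V} (hz : z ∈ compSet x) (hz' : z ∈ compSet x') : compSet x ⊆ compSet x' := by
      intro y hy
      obtain ⟨m, n, hmn⟩ := hcompjoin hy hz
      obtain ⟨-, m', n', hmn'⟩ := hz'
      refine ⟨hy.1, m' + m, n + n', ?_⟩
      rw [Function.iterate_add_apply, hmn, ← Function.iterate_add_apply, add_comm m' n,
        Function.iterate_add_apply, hmn', Function.iterate_add_apply]
    rw [Set.disjoint_left]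
    intro z hz hz'
    have hz1 : z ∈ (et.symm j).1 := hz
    have hz2 : z ∈ (et.symm j').1 := hz'
    refine hne (et.symm.injective (Subtype.ext ?_))
    rw [hS] at hz1 ⊢
    rw [hS'] at hz2 ⊢
    exact (key hz1 hz2).antisymm (key hz2 hz1)
  · intro i j
    obtain ⟨x, hx, hfix, hS⟩ := (et.symm j).2
    rw [Set.disjoint_left]
    rintro z ⟨-, n, hn⟩ hz
    have hz1 : z ∈ (et.symm j).1 := hz
    rw [hS] at hz1
    refine hcompfix hfix hz1 n ?_
    rw [hn]
    exact (hv i).2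
  · intro i
    rw [← hverts]
    exact ⟨(hroot (hv i).1 (hv i).2).1, (hroot (hv i).1 (hv i).2).2.1⟩
  · rw [← Set.inter_union_distrib_left, Set.compl_union_self, Set.inter_univ]
  · exact Set.disjoint_left.2 fun x hx hx' => hx.2 hx'.2
  · intro a ha b hb _ hab
    exact (hC.1 hab).elim ha.2 hb.2
  · rintro _ ⟨⟨i, rfl⟩, hi⟩
    exact ((hroot (hv i).1 (hv i).2).2.2 hi).2.1
  · intro i hi
    exact ((hroot (hv i).1 (hv i).2).2.2 hi.2).1
  · rintro x (⟨⟨i, rfl⟩, hi⟩ | hx) y hy hxy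
    · exact hy.2 (((hroot (hv i).1 (hv i).2).2.2 hi).2.2 y hxy)
    · exact hy.2 (hchild (hinner x hx) y hxy)

theorem hasGeneratingStarSemiForest_iff [Finite V] {K : D.G.Subgraph} :
    D.HasGeneratingStarSemiForest K ↔ ∃ C, D.IsStrongCover C ∧ K.verts ⊆ C := by
  constructor
  · rintro ⟨H, hH, hKH⟩
    rw [hKH]
    exact hH.exists_isStrongCover
  · rintro ⟨C, hC, hK⟩
    exact hC.hasGeneratingStarSemiForest hK

end WeightedOrientedGraph

/-! ### The weak perfect graph theorem and clique τ-reductions. -/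

namespace SimpleGraph

variable {V : Type*}

open Finset in
/-- If every set of vertices `A` satisfies `|A| ≤ ω α` for some clique of size `ω` and some stable
set of size `α` in `A`, then every set of vertices can be coloured with as many colours as some
clique in it has vertices. -/
theorem exists_clique_coloring_of_card_le_mul (F : SimpleGraph V)
    (hF : ∀ A : Finset V, ∃ s ⊆ A, ∃ t ⊆ A, F.IsClique s ∧ F.IsIndepSet t ∧ #A ≤ #s * #t)
    (A : Finset V) : ∃ s ⊆ A, F.IsClique s ∧
      ∃ c : V → ℕ, (∀ v ∈ A, c v < #s) ∧ ∀ v ∈ A, ∀ w ∈ A, F.Adj v w → c v ≠ c w := by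
  classical
  induction A using Finset.strongInduction with
  | H A ih =>
  obtain ⟨s, hs, hmax⟩ := Finset.exists_max_image
    (A.powerset.filter fun s : Finset V => F.IsClique (s : Set V)) card ⟨∅, by simp⟩
  rw [mem_filter, mem_powerset] at hs
  replace hmax : ∀ s' ⊆ A, F.IsClique s' → #s' ≤ #s := fun s' h1 h2 => hmax s' (by simp [h1, h2])
  by_contra hcon
  have hncol (c : V → ℕ) (hc : ∀ v ∈ A, c v < #s) :
      ¬ ∀ v ∈ A, ∀ w ∈ A, F.Adj v w → c v ≠ c w :=
    fun h => hcon ⟨s, hs.1, hs.2, c, hc, h⟩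
  obtain ⟨s₀, hs₀A, t, htA, hs₀, ht, hcard⟩ := hF A
  replace hcard : #A ≤ #s * #t := hcard.trans (Nat.mul_le_mul_right _ (hmax s₀ hs₀A hs₀))
  have hApos : 0 < #A := by
    rw [Finset.card_pos]
    by_contra hne
    rw [not_nonempty_iff_eq_empty] at hne
    subst hne
    exact hncol (fun _ => 0) (by simp) (by simp)
  have hcol (a : t) : ∃ c : V → ℕ, (∀ v ∈ A.erase a, c v < #s) ∧
      ∀ v ∈ A.erase a, ∀ w ∈ A.erase a, F.Adj v w → c v ≠ c w := by
    obtain ⟨s', hs'A, hs', c, hc, hproper⟩ := ih (A.erase a) (erase_ssubset (htA a.2))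
    exact ⟨c, fun v hv => (hc v hv).trans_le (hmax s' (hs'A.trans (erase_subset _ _)) hs'),
      hproper⟩
  choose c hc hproper using hcol
  -- In a minimal counterexample `A`, these are `ωα + 1` stable sets: `t`, and the classes of an
  -- `ω`-colouring of `A` minus `a` for each `a ∈ t`.
  let S : Option (t × Fin #s) → Finset V
    | none => t
    | some (a, k) => {v ∈ A.erase a | c a v = k}
  have hSA (i) : S i ⊆ A := by
    rcases i with _ | ⟨a, k⟩
    · exact htA
    · exact (filter_subset _ _).trans (erase_subset _ _)
  have hSindep (i) : F.IsIndepSet (S i : Set V) := by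
    rcases i with _ | ⟨a, k⟩
    · exact ht
    · intro v hv w hw _ hvw
      have hv' : v ∈ A.erase a ∧ c a v = k := mem_filter.1 hv
      have hw' : w ∈ A.erase a ∧ c a w = k := mem_filter.1 hw
      exact hproper a v hv'.1 w hw'.1 hvw (hv'.2.trans hw'.2.symm)
  -- If every clique in `A \ S i` had fewer than `ω` vertices, that set would need fewer than `ω`
  -- colours, and `S i` could serve as one more class.
  have hclique (i) : ∃ Q ⊆ A, F.IsClique (Q : Set V) ∧ #Q = #s ∧ Disjoint Q (S i) := by
    by_cases hne : (S i).Nonempty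
    · have hss : A \ S i ⊂ A := sdiff_ssubset (hSA i) hne
      obtain ⟨Q, hQA, hQ, d, hd, hdp⟩ := ih _ hss
      refine ⟨Q, hQA.trans sdiff_subset, hQ, ?_, ?_⟩
      · refine le_antisymm (hmax Q (hQA.trans sdiff_subset) hQ) ?_
        by_contra! hlt
        refine hncol (fun v => if v ∈ S i then #Q else d v) (fun v hv => ?_)
          fun v hv w hw hvw => ?_
        · split_ifs with h
          · exact hlt
          · exact (hd v (mem_sdiff.2 ⟨hv, h⟩)).trans hlt
        · split_ifs with h1 h2 h2
          · exact (hSindep i h1 h2 hvw.ne hvw).elim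
          · exact (hd w (mem_sdiff.2 ⟨hw, h2⟩)).ne'
          · exact (hd v (mem_sdiff.2 ⟨hv, h1⟩)).ne
          · exact hdp v (mem_sdiff.2 ⟨hv, h1⟩) w (mem_sdiff.2 ⟨hw, h2⟩) hvw
      · exact disjoint_of_subset_left hQA sdiff_disjoint
    · rw [not_nonempty_iff_eq_empty] at hne
      exact ⟨s, hs.1, hs.2, rfl, by simp [hne]⟩
  choose Q hQA hQ hQcard hQS using hclique
  have hle (i j) : #(Q i ∩ S j) ≤ 1 := by
    rw [card_le_one]
    intro v hv w hw
    rw [mem_inter] at hv hw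
    by_contra hvw
    exact hSindep j hv.2 hw.2 hvw (hQ i hv.1 hw.1 hvw)
  -- For each `a ∈ t` the colour classes contain `ω` vertices of `Q i`, or `ω - 1` if `a ∈ Q i`; the
  -- loss is made up by `a` in the class `t`.
  have hsum (i) : ∑ j, #(Q i ∩ S j) = #s * #t := by
    have hclass (a : t) : ∑ k : Fin #s, #(Q i ∩ S (some (a, k))) = #((Q i).erase a) := by
      rw [card_eq_sum_card_fiberwise (f := c a) (t := range #s)
        (fun v hv => mem_coe.2 (mem_range.2 (hc a v
          (mem_erase.2 ⟨(mem_erase.1 hv).1, hQA i (mem_erase.1 hv).2⟩)))),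
        ← Fin.sum_univ_eq_sum_range
        (fun k => #{v ∈ (Q i).erase a | c a v = k})]
      refine sum_congr rfl fun k _ => congrArg card ?_
      ext v
      have := @hQA i v
      simp only [S, mem_inter, mem_filter, mem_erase]
      tauto
    have hQt : #(Q i ∩ t) = ∑ a : t, if (a : V) ∈ Q i then 1 else 0 := by
      rw [sum_coe_sort t (fun a => if a ∈ Q i then 1 else 0), ← card_filter, inter_comm,
        filter_mem_eq_inter]
    rw [Fintype.sum_option, Fintype.sum_prod_type]
    simp only [hclass]
    change #(Q i ∩ t) + _ = _
    rw [hQt, ← sum_add_distrib]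
    have hterm (a : t) : (if (a : V) ∈ Q i then 1 else 0) + #((Q i).erase a) = #s := by
      split_ifs with h
      · rw [card_erase_of_mem h, hQcard]
        have := card_pos.2 ⟨_, h⟩
        rw [hQcard] at this
        omega
      · rw [erase_eq_of_notMem h, hQcard, zero_add]
    simp only [hterm]
    simp [mul_comm]
  have hone (i j) (hij : j ≠ i) : #(Q i ∩ S j) = 1 := by
    refine le_antisymm (hle i j) ?_
    by_contra! hlt
    have hi : #(Q i ∩ S i) = 0 := by
      rw [card_eq_zero, ← disjoint_iff_inter_eq_empty]
      exact hQS i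
    have hbound : ∑ k, #(Q i ∩ S k) + 2 ≤ Fintype.card (Option (t × Fin #s)) := by
      rw [← add_sum_erase univ _ (mem_univ i),
        ← add_sum_erase (univ.erase i) _ (mem_erase.2 ⟨hij, mem_univ j⟩), hi,
        Nat.lt_one_iff.1 hlt]
      have h1 := sum_le_card_nsmul ((univ.erase i).erase j) (fun k => #(Q i ∩ S k)) 1
        (fun k _ => hle i k)
      have h2 : #((univ.erase i).erase j) + 2 = Fintype.card (Option (t × Fin #s)) := by
        have h3 := card_erase_add_one (mem_univ i)
        have h4 := card_erase_add_one (mem_erase.2 ⟨hij, mem_univ j⟩)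
        rw [card_univ] at h3
        omega
      rw [smul_eq_mul, mul_one] at h1
      omega
    rw [hsum, Fintype.card_option, Fintype.card_prod, Fintype.card_coe, Fintype.card_fin,
      mul_comm] at hbound
    omega
  -- The clique incidences with the sets `S j` form `J - I` (`J` the all-ones matrix), which is
  -- nonsingular. So the columns of `M` are independent and `ωα + 1 ≤ |A|`, a contradiction.
  let M : Matrix A (Option (t × Fin #s)) ℚ := Matrix.of fun v j => if (v : V) ∈ S j then 1 else 0
  have hinj : Function.Injective M.mulVecLin := by
    rw [injective_iff_map_eq_zero]
    intro x hx
    have hrow (v : V) (hv : v ∈ A) : ∑ j, (if v ∈ S j then x j else 0) = 0 := by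
      have := congrFun hx ⟨v, hv⟩
      simpa [M, Matrix.mulVec, dotProduct] using this
    have hclq (i) : ∑ j, (#(Q i ∩ S j) : ℚ) * x j = 0 := by
      have h1 : ∑ v ∈ Q i, ∑ j, (if v ∈ S j then x j else 0) = 0 :=
        sum_eq_zero fun v hv => hrow v (hQA i hv)
      rw [sum_comm] at h1
      rw [← h1]
      refine sum_congr rfl fun j _ => ?_
      rw [← sum_filter, filter_mem_eq_inter, sum_const, nsmul_eq_mul]
    have hall (i) : x i = ∑ j, x j := by
      have h1 := hclq i
      rw [← add_sum_erase univ _ (mem_univ i)] at h1 ⊢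
      have hi : #(Q i ∩ S i) = 0 := by
        rw [card_eq_zero, ← disjoint_iff_inter_eq_empty]
        exact hQS i
      have h2 : ∑ j ∈ univ.erase i, (#(Q i ∩ S j) : ℚ) * x j = ∑ j ∈ univ.erase i, x j :=
        sum_congr rfl fun j hj => by rw [hone i j (ne_of_mem_erase hj)]; simp
      rw [h2, hi] at h1
      simp only [Nat.cast_zero, zero_mul, zero_add] at h1
      rw [h1, add_zero]
    have htot : ∑ j, x j = (#s * #t + 1 : ℕ) * ∑ j, x j := by
      conv_lhs => rw [sum_congr rfl fun j _ => hall j]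
      rw [sum_const, nsmul_eq_mul, card_univ, Fintype.card_option, Fintype.card_prod,
        Fintype.card_coe, Fintype.card_fin, mul_comm #t]
    have hpos : (0 : ℚ) < (#s * #t : ℕ) := by exact_mod_cast hApos.trans_le hcard
    have hzero : ∑ j, x j = 0 := by
      rw [Nat.cast_succ, add_mul, one_mul, right_eq_add] at htot
      exact (mul_eq_zero.1 htot).resolve_left hpos.ne'
    funext i
    rw [hall i, hzero]
    rfl
  have := LinearMap.finrank_le_finrank_of_injective hinj
  rw [Module.finrank_fintype_fun_eq_card, Module.finrank_fintype_fun_eq_card, Fintype.card_option,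
    Fintype.card_prod, Fintype.card_coe, Fintype.card_coe, Fintype.card_fin, mul_comm] at this
  omega

open Finset in
-- Among `ω` colour classes covering `A`, the largest has at least `|A| / ω` vertices.
theorem IsPerfectGraph.exists_card_le_mul [Finite V] {G : SimpleGraph V} (hG : G.IsPerfectGraph)
    (A : Finset V) :
    ∃ s ⊆ A, ∃ t ⊆ A, G.IsClique s ∧ G.IsIndepSet t ∧ #A ≤ #s * #t := by
  classical
  have hcol : (G.induce (A : Set V)).Colorable (G.induce (A : Set V)).cliqueNum :=
    chromaticNumber_le_iff_colorable.1 (hG A).le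
  obtain ⟨s, hs⟩ := (G.induce (A : Set V)).exists_isNClique_cliqueNum
  obtain ⟨c⟩ := hcol
  rcases A.eq_empty_or_nonempty with rfl | ⟨a, ha⟩
  · exact ⟨∅, subset_rfl, ∅, subset_rfl, by simp⟩
  let cls (k : Fin (G.induce (A : Set V)).cliqueNum) : Finset (A : Set V) := {v | c v = k}
  obtain ⟨k, -, hk⟩ := exists_max_image univ (fun k => #(cls k)) ⟨c ⟨a, ha⟩, mem_univ _⟩
  have hsub (r : Finset (A : Set V)) : r.map (Function.Embedding.subtype _) ⊆ A := by
    intro v hv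
    obtain ⟨w, -, rfl⟩ := mem_map.1 hv
    exact w.2
  refine ⟨s.map (Function.Embedding.subtype _), hsub _, (cls k).map (Function.Embedding.subtype _),
    hsub _, ?_, ?_, ?_⟩
  · intro v hv w hw hvw
    obtain ⟨v', hv', rfl⟩ := mem_map.1 (mem_coe.1 hv)
    obtain ⟨w', hw', rfl⟩ := mem_map.1 (mem_coe.1 hw)
    exact hs.isClique hv' hw' fun h => hvw (h ▸ rfl)
  · intro v hv w hw hvw hadj
    obtain ⟨v', hv', rfl⟩ := mem_map.1 (mem_coe.1 hv)
    obtain ⟨w', hw', rfl⟩ := mem_map.1 (mem_coe.1 hw)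
    have h1 : c v' = k := (mem_filter.1 hv').2
    have h2 : c w' = k := (mem_filter.1 hw').2
    exact c.valid (v := v') (w := w') hadj (h1.trans h2.symm)
  · rw [card_map, card_map, hs.card_eq]
    have h1 : #A = Fintype.card (A : Set V) := by simp
    rw [h1, ← card_univ, card_eq_sum_card_fiberwise (f := c) (t := univ) (fun _ _ => by simp)]
    refine (sum_le_card_nsmul _ _ _ fun j hj => hk j hj).trans ?_
    simp

/-- A perfect graph has a stable set `S` and a colouring of the complement whose colours correspond
to the elements of `S`. -/
theorem IsPerfectGraph.exists_isIndepSet_coloring_compl [Finite V] {G : SimpleGraph V}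
    (hG : G.IsPerfectGraph) :
    ∃ S : Finset V, G.IsIndepSet S ∧ Nonempty (Gᶜ.Coloring (Fin S.card)) := by
  classical
  cases nonempty_fintype V
  obtain ⟨S, -, hS, c, hc, hproper⟩ := exists_clique_coloring_of_card_le_mul Gᶜ (fun A => by
    obtain ⟨s, hs, t, ht, hsc, hti, hle⟩ := hG.exists_card_le_mul A
    exact ⟨t, ht, s, hs, by simpa using hti, by simpa using hsc, by rwa [mul_comm]⟩) Finset.univ
  refine ⟨S, by simpa using hS, ⟨Coloring.mk (fun v => ⟨c v, hc v (Finset.mem_univ v)⟩) ?_⟩⟩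
  intro v w hvw h
  exact hproper v (Finset.mem_univ v) w (Finset.mem_univ w) hvw (congrArg Fin.val h)

theorem Subgraph.vertexCoverNum_coe_of_eq_top [Finite V] {G : SimpleGraph V} {H : G.Subgraph}
    (hH : H.coe = ⊤) : H.coe.vertexCoverNum = ((H.verts.ncard - 1 : ℕ) : ℕ∞) := by
  have : ENat.card H.verts = (H.verts.ncard : ℕ∞) := by
    rw [ENat.card_eq_coe_natCard, Nat.card_coe_set_eq]
  rw [hH]
  refine (vertexCoverNum_top (V := H.verts)).trans ?_
  rw [this]
  simp

/-- A vertex cover misses at most one vertex of a complete subgraph. -/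
theorem IsVertexCover.ncard_sub_one_le [Finite V] {G : SimpleGraph V} {C : Set V}
    (hC : G.IsVertexCover C) {H : G.Subgraph} (hH : H.coe = ⊤) :
    H.verts.ncard - 1 ≤ (C ∩ H.verts).ncard := by
  have hsub : (H.verts \ C).ncard ≤ 1 := by
    rw [Set.ncard_le_one (Set.toFinite _)]
    rintro a ⟨haH, haC⟩ b ⟨hbH, hbC⟩
    by_contra hab
    have : H.coe.Adj ⟨a, haH⟩ ⟨b, hbH⟩ := by
      rw [hH]
      exact fun h => hab (congrArg Subtype.val h)
    exact (hC (H.adj_sub this)).elim haC hbC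
  have := Set.ncard_inter_add_ncard_sdiff_eq_ncard H.verts C (Set.toFinite _)
  rw [Set.inter_comm]
  omega

theorem ncard_eq_sum_ncard_inter [Finite V] {s : ℕ} {A : Fin s → Set V}
    (hdisj : ∀ i j, i ≠ j → Disjoint (A i) (A j)) (hcover : (⋃ i, A i) = Set.univ) (C : Set V) :
    C.ncard = ∑ i, (C ∩ A i).ncard := by
  have hC : C = ⋃ i, C ∩ A i := by rw [← Set.inter_iUnion, hcover, Set.inter_univ]
  conv_lhs => rw [hC]
  rw [Set.ncard_iUnion_of_finite (fun _ => Set.toFinite _), finsum_eq_sum_of_fintype]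
  intro i j hij
  exact (hdisj i j hij).mono Set.inter_subset_right Set.inter_subset_right

/-- `S` is a clique of the complement with as many vertices as there are colours, so every class
contains exactly one vertex of `S`. This makes the number of colours least, and the cover `Sᶜ`
attains the lower bound `∑ (|H_i| - 1)`. -/
theorem IsPerfectGraph.exists_coloring_compl_isTauReduction [Finite V] {G : SimpleGraph V}
    (hG : G.IsPerfectGraph) :
    ∃ (s : ℕ) (c : Gᶜ.Coloring (Fin s)),
      (s : ℕ∞) = Gᶜ.chromaticNumber ∧
      G.IsTauReduction (fun i => (⊤ : G.Subgraph).induce (c.colorClass i)) ∧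
      ∀ i, ((⊤ : G.Subgraph).induce (c.colorClass i)).coe = ⊤ := by
  obtain ⟨S, hS, ⟨c⟩⟩ := hG.exists_isIndepSet_coloring_compl
  have hSc : Gᶜ.IsClique S := by simpa using hS
  have htop (i) : ((⊤ : G.Subgraph).induce (c.colorClass i)).coe = ⊤ := by
    ext ⟨a, ha⟩ ⟨b, hb⟩
    have ha' : c a = i := ha
    have hb' : c b = i := hb
    simp only [Subgraph.coe_adj, Subgraph.induce_adj, Subgraph.top_adj, top_adj, ne_eq,
      Subtype.mk.injEq]
    refine ⟨fun h => h.2.2.ne, fun hab => ⟨ha, hb, ?_⟩⟩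
    by_contra hadj
    exact c.valid ((compl_adj G a b).2 ⟨hab, hadj⟩) (ha'.trans hb'.symm)
  have hsurj (i) : ∃ v ∈ S, c v = i := by
    have hinj : Set.InjOn c S := fun a ha b hb h => by
      by_contra hab
      exact c.valid (hSc ha hb hab) h
    have := Finset.eq_univ_of_card (S.image c) (by
      rw [Finset.card_image_of_injOn hinj, Fintype.card_fin])
    exact Finset.mem_image.1 (this ▸ Finset.mem_univ i)
  have hdisj (i j) (hij : i ≠ j) : Disjoint (c.colorClass i) (c.colorClass j) :=
    Set.disjoint_left.2 fun v (hv : c v = i) (hv' : c v = j) => hij (hv.symm.trans hv')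
  have hcover : (⋃ i, c.colorClass i) = Set.univ :=
    Set.eq_univ_of_forall fun v => Set.mem_iUnion.2 ⟨c v, rfl⟩
  have hne (i) : (c.colorClass i).Nonempty := (hsurj i).imp fun v hv => hv.2
  refine ⟨_, c, ?_, ⟨hne, fun i => ?_, hdisj, hcover, ?_⟩, htop⟩
  · refine le_antisymm hSc.card_le_chromaticNumber ?_
    simpa using c.colorable.chromaticNumber_le
  · intro a ha b hb hab
    exact ⟨ha, hb, hab⟩
  · simp only [fun i => Subgraph.vertexCoverNum_coe_of_eq_top (htop i)]
    rw [← Nat.cast_sum]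
    apply le_antisymm
    · refine (isVertexCover_compl.2 hS).vertexCoverNum_le.trans ?_
      rw [← (Set.toFinite _).cast_ncard_eq, Nat.cast_le]
      have h1 := ncard_eq_sum_ncard_inter hdisj hcover (S : Set V)ᶜ
      rw [h1]
      refine Finset.sum_le_sum fun i _ => ?_
      obtain ⟨v, hvS, hv⟩ := hsurj i
      have h2 : ((S : Set V)ᶜ ∩ c.colorClass i) ⊆ c.colorClass i \ {v} :=
        fun x hx => ⟨hx.2, fun h => hx.1 (h ▸ hvS)⟩
      refine (Set.ncard_le_ncard h2 (Set.toFinite _)).trans ?_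
      rw [Set.ncard_sdiff_singleton_of_mem (show v ∈ c.colorClass i from hv)]
      rfl
    · obtain ⟨C, hCcard, hC⟩ := vertexCoverNum_exists G
      rw [← hCcard, ← (Set.toFinite C).cast_ncard_eq, Nat.cast_le,
        ncard_eq_sum_ncard_inter hdisj hcover C]
      exact Finset.sum_le_sum fun i _ => hC.ncard_sub_one_le (htop i)

end SimpleGraph

/-! ### Comparing the sizes of strong covers along a τ-reduction. -/

namespace WeightedOrientedGraph

variable {V : Type*} {D : WeightedOrientedGraph V}

/-- A vertex cover of least cardinality is strong. -/
theorem isStrongCover_of_encard_eq [Finite V] {C : Set V} (hC : D.G.IsVertexCover C)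
    (hcard : C.encard = D.G.vertexCoverNum) : D.IsStrongCover C := by
  refine ⟨hC, fun x hx hN => ?_⟩
  have hsmall : D.G.IsVertexCover (C \ {x}) := by
    intro a b hab
    by_cases hax : a = x
    · subst hax
      exact Or.inr ⟨hN b hab, hab.ne'⟩
    · by_cases hbx : b = x
      · subst hbx
        exact Or.inl ⟨hN a hab.symm, hax⟩
      · exact (hC hab).imp (fun h => ⟨h, hax⟩) fun h => ⟨h, hbx⟩
  have hle := hsmall.vertexCoverNum_le
  rw [← hcard] at hle
  have hlt : (C \ {x}).encard < C.encard := (Set.toFinite _).encard_lt_encard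
    ⟨Set.sdiff_subset, fun h => (h hx).2 rfl⟩
  exact (hlt.not_ge hle).elim

theorem isUnmixedIdeal_edgeIdeal_iff_of_isTauReduction [Finite V] (K : Type*) [Field K]
    {s : ℕ} {H : Fin s → D.G.Subgraph} (hH : D.G.IsTauReduction H) (htop : ∀ i, (H i).coe = ⊤) :
    (D.edgeIdeal K).IsUnmixedIdeal ↔ ∀ i, ¬ D.HasGeneratingStarSemiForest (H i) := by
  obtain ⟨hne, -, hdisj, hcover, htau⟩ := hH
  simp only [fun i => SimpleGraph.Subgraph.vertexCoverNum_coe_of_eq_top (htop i)] at htau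
  rw [← Nat.cast_sum] at htau
  -- Nonemptiness makes the truncated `|H_i| - 1` strictly smaller than `|H_i|`, so a cover
  -- containing all of `H i` exceeds `τ(G)`.
  have hpos (i) : 0 < (H i).verts.ncard := (Set.ncard_pos (Set.toFinite _)).2 (hne i)
  rw [isUnmixedIdeal_edgeIdeal_iff]
  simp only [hasGeneratingStarSemiForest_iff]
  constructor
  · rintro hun i ⟨C, hC, hiC⟩
    obtain ⟨C₀, hcard, hC₀⟩ := SimpleGraph.vertexCoverNum_exists D.G
    have heq := hun C C₀ hC (isStrongCover_of_encard_eq hC₀ hcard)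
    rw [hcard, htau, ← (Set.toFinite C).cast_ncard_eq, Nat.cast_inj,
      SimpleGraph.ncard_eq_sum_ncard_inter hdisj hcover C] at heq
    refine (Finset.sum_lt_sum (fun j _ => hC.1.ncard_sub_one_le (htop j))
      ⟨i, Finset.mem_univ i, ?_⟩).ne' heq
    rw [Set.inter_eq_right.2 hiC]
    exact Nat.sub_lt (hpos i) one_pos
  · intro hno
    have key {C : Set V} (hC : D.IsStrongCover C) :
        C.encard = (∑ i, ((H i).verts.ncard - 1) : ℕ) := by
      rw [← (Set.toFinite C).cast_ncard_eq, Nat.cast_inj,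
        SimpleGraph.ncard_eq_sum_ncard_inter hdisj hcover C]
      refine Finset.sum_congr rfl fun i _ => le_antisymm ?_ (hC.1.ncard_sub_one_le (htop i))
      refine Nat.le_sub_one_of_lt (Set.ncard_lt_ncard ?_ (Set.toFinite _))
      exact ⟨Set.inter_subset_right, fun h => hno i ⟨C, hC, fun x hx => (h hx).1⟩⟩
    intro C C' hC hC'
    rw [key hC, key hC']

end WeightedOrientedGraph

/-- If the underlying graph is perfect, then the colour classes of some colouring of the complement
with the least number of colours induce a τ-reduction into complete subgraphs; and for every
τ-reduction into complete subgraphs, the edge ideal is unmixed if and only if no member of the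
τ-reduction has a generating ⋆-semi-forest. -/
theorem mainTheorem3 {V : Type*} [Finite V] (K : Type*) [Field K]
    (D : WeightedOrientedGraph V) (hG : D.G.IsPerfectGraph) :
    (∃ (s : ℕ) (c : D.Gᶜ.Coloring (Fin s)),
      (s : ℕ∞) = D.Gᶜ.chromaticNumber ∧
      D.G.IsTauReduction (fun i => (⊤ : D.G.Subgraph).induce (c.colorClass i)) ∧
      ∀ i, ((⊤ : D.G.Subgraph).induce (c.colorClass i)).coe = ⊤) ∧
    ∀ (s : ℕ) (H : Fin s → D.G.Subgraph),
      D.G.IsTauReduction H → (∀ i, (H i).coe = ⊤) →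
      ((D.edgeIdeal K).IsUnmixedIdeal ↔ ∀ i, ¬ D.HasGeneratingStarSemiForest (H i)) := by
  exact ⟨hG.exists_coloring_compl_isTauReduction, fun _ _ hH htop =>
    D.isUnmixedIdeal_edgeIdeal_iff_of_isTauReduction K hH htop⟩
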